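/- **Conventions.** A metric space $X$ is *geodesic* if any two points $x,y\in X$ are joined by a path of length $d(x,y)$. For $s>0$, a subset $S\subseteq X$ is *$s$-dense* if for every $x\in X$ there is $y\in S$ with $d(x,y)<s$; $S$ carries the restricted metric. For a metric space $Y$ and $r>0$, $\operatorname{Rips}(Y,r)$ is the simplicial complex with vertex set $Y$ whose simplices are the finite nonempty subsets of diameter $<r$. An *$r$-loop* in $Y$ based at $\bullet\in Y$ is a finite sequence $\bullet=x_0,x_1,\dots,x_{k+1}=\bullet$ in $Y$ with $d(x_i,x_{i+1})<r$ for all $i$; it has a class $[L]_{\pi_1}\in\pi_1(\operatorname{Rips}(Y,r),\bullet)$ and, for an Abelian group $G$ and $g\in G$, a class $g[L]\in H_1(\operatorname{Rips}(Y,r);G)$. For $0<p\le q$ let $i^{Y}_{p,q}$ denote the map induced on $\pi_1(-,\bullet)$, or on $H_1(-;G)$, by the inclusion $\operatorname{Rips}(Y,p)\hookrightarrow\operatorname{Rips}(Y,q)$. For $S\subseteq X$ containing $\bullet$ let $\mu_p$ denote the map induced on $\pi_1(-,\bullet)$, or on $H_1(-;G)$, by the inclusion $\operatorname{Rips}(S,p)\hookrightarrow\operatorname{Rips}(X,p)$.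 For $a,c\ge 0$, an *$(a,c)$-interleaving* of persistences $\{A_r\}_{r>0}$ and $\{B_r\}_{r>0}$ (with bonding maps $A_r\to A_{r'}$ and $B_r\to B_{r'}$ for $r\le r'$) is a family of homomorphisms $f_r\colon A_r\to B_{r+a}$ and $g_r\colon B_r\to A_{r+c}$ that commute with the bonding maps and such that $g_{r+a}f_r$ and $f_{r+c}g_r$ are the bonding maps $A_r\to A_{r+a+c}$ and $B_r\to B_{r+a+c}$. **Proposition.** Let $X$ be a geodesic space, $G$ an Abelian group, $s>0$, and $S\subseteq X$ an $s$-dense subset containing the basepoint $\bullet$. 1. *($\nu$ is well defined.)* For every $p>0$ there is a unique homomorphism $$\nu_p\colon \pi_1(\operatorname{Rips}(X,p),\bullet)\to\pi_1(\operatorname{Rips}(S,p+2s),\bullet)$$ whose graph is the set of all pairs $([L]_{\pi_1},[L_S]_{\pi_1})$, where $L=(x_0,\dots,x_{k+1})$ is a $p$-loop in $X$ based at $\bullet$ and $L_S=(y_0,\dots,y_{k+1})$ is a sequence in $S$ with $y_0=y_{k+1}=\bullet$ and $d(x_i,y_i)<s$ for all $i$ (such an $L_S$ is automatically a $(p+2s)$-loop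 in $S$). Likewise there is a unique homomorphism $$\nu_p\colon H_1(\operatorname{Rips}(X,p);G)\to H_1(\operatorname{Rips}(S,p+2s);G)$$ whose graph is the set of all pairs $\bigl(\sum_j g_j[L_j],\ \sum_j g_j[(L_j)_S]\bigr)$, over all finite families of $g_j\in G$, of $p$-loops $L_j$ in $X$ based at $\bullet$, and of sequences $(L_j)_S$ chosen for $L_j$ as above. 2. *(Diagrams.)* Both for $\pi_1$ and for $H_1(-;G)$, for all $0<p<q$: $$\nu_p\circ\mu_p=i^{S}_{p,p+2s},\qquad \mu_{p+2s}\circ\nu_p=i^{X}_{p,p+2s},\qquad \mu_q\circ i^{S}_{p,q}=i^{X}_{p,q}\circ\mu_p .$$ 3. *(Interleaving.)* The maps $f_r=\mu_r$ and $g_r=\nu_r$ form a $(0,2s)$-interleaving of $\{\pi_1(\operatorname{Rips}(S,r),\bullet)\}_{r>0}$ and $\{\pi_1(\operatorname{Rips}(X,r),\bullet)\}_{r>0}$, and likewise of $\{H_1(\operatorname{Rips}(S,r);G)\}_{r>0}$ and $\{H_1(\operatorname{Rips}(X,r);G)\}_{r>0}$. -/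

import Mathlib

open CategoryTheory
open scoped NNReal

universe u v w

noncomputable section

/-! ### Geodesic spaces and dense samples -/

/-- A metric space is geodesic if any two points `x`, `y` are joined by a path of length
`d(x, y)`. -/
def IsGeodesicSpace (X : Type u) [MetricSpace X] : Prop :=
  ∀ x y : X, ∃ γ : Path x y, eVariationOn γ Set.univ = edist x y

/-- `S` is `s`-dense if every point of `X` is at distance less than `s` from a point of `S`. -/
def IsDenseSample {X : Type u} [MetricSpace X] (S : Set X) (s : ℝ) : Prop :=
  ∀ x : X, ∃ y ∈ S, dist x y < s

/-! ### Simplicial maps and geometric realizations -/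

/-- A simplicial map: a map of vertices that sends every simplex into a simplex. -/
@[ext]
structure SimplicialMap {V : Type u} {W : Type v} (K : AbstractSimplicialComplex V)
    (L : AbstractSimplicialComplex W) where
  onVertices : V → W
  map_face : ∀ σ ∈ K.faces, ∃ τ ∈ L.faces, ∀ x ∈ σ, onVertices x ∈ τ

/-- The identity simplicial map. -/
def SimplicialMap.id {V : Type u} (K : AbstractSimplicialComplex V) : SimplicialMap K K where
  onVertices x := x
  map_face σ hσ := ⟨σ, hσ, fun _ hx => hx⟩

/-- The composition `ψ ∘ φ` of simplicial maps. -/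
def SimplicialMap.comp {V₁ V₂ V₃ : Type*} {K : AbstractSimplicialComplex V₁}
    {L : AbstractSimplicialComplex V₂} {M : AbstractSimplicialComplex V₃}
    (ψ : SimplicialMap L M) (φ : SimplicialMap K L) : SimplicialMap K M where
  onVertices x := ψ.onVertices (φ.onVertices x)
  map_face σ hσ := by
    obtain ⟨τ, hτ, h⟩ := φ.map_face σ hσ
    obtain ⟨ρ, hρ, h'⟩ := ψ.map_face τ hτ
    exact ⟨ρ, hρ, fun x hx => h' _ (h x hx)⟩

/-- The points of the geometric realization of `K`: formal convex combinations of vertices whose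
support is a simplex of `K`. -/
@[ext]
structure Realization {V : Type u} (K : AbstractSimplicialComplex V) where
  weight : V →₀ ℝ
  nonneg : ∀ x, 0 ≤ weight x
  sum_eq_one : (weight.sum fun _ a => a) = 1
  support_mem : weight.support ∈ K.faces

namespace Realization

variable {V : Type u} {W : Type v} {K : AbstractSimplicialComplex V}
  {L : AbstractSimplicialComplex W}

/-- Formal convex combinations supported in a face are points of the realization. -/
def ofSubset (t : V →₀ ℝ) (h0 : ∀ x, 0 ≤ t x) (h1 : (t.sum fun _ a => a) = 1)
    (h : ∃ σ ∈ K.faces, ∀ x ∈ t.support, x ∈ σ) : Realization K where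
  weight := t
  nonneg := h0
  sum_eq_one := h1
  support_mem := by
    obtain ⟨σ, hσ, hsub⟩ := h
    refine (K.isRelLowerSet_faces hσ).2 hsub ?_
    rw [Finset.nonempty_iff_ne_empty]
    intro he
    rw [Finsupp.support_eq_empty] at he
    simp [he] at h1

/-- The inclusion of the closed simplex spanned by the face `σ`. -/
def faceMap (σ : K.faces) (t : stdSimplex ℝ σ.1) : Realization K :=
  ofSubset (Finsupp.mapDomain Subtype.val (Finsupp.equivFunOnFinite.symm (t : σ.1 → ℝ)))
    (by
      classical
      intro x
      by_cases hx : x ∈ σ.1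
      · have := Finsupp.mapDomain_apply (f := (Subtype.val : σ.1 → V)) Subtype.val_injective
          (Finsupp.equivFunOnFinite.symm (t : σ.1 → ℝ)) ⟨x, hx⟩
        rw [this]
        exact t.2.1 _
      · rw [Finsupp.mapDomain_of_notMem_range]
        simpa using hx)
    (by
      rw [Finsupp.sum_mapDomain_index (by simp) (by simp), Finsupp.sum_fintype _ _ (by simp)]
      exact t.2.2)
    ⟨σ.1, σ.2, by
      classical
      intro x hx
      have := Finsupp.mapDomain_support hx
      simp only [Finset.mem_image] at this
      obtain ⟨y, _, rfl⟩ := this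
      exact y.2⟩

/-- The weak topology: a set is open iff its intersection with each closed simplex is open. -/
instance : TopologicalSpace (Realization K) :=
  ⨆ σ : K.faces, TopologicalSpace.coinduced (faceMap σ) inferInstance

theorem continuous_faceMap (σ : K.faces) : Continuous (faceMap σ) :=
  continuous_iSup_rng (i := σ) continuous_coinduced_rng

/-- The vertex of the realization given by `x`. -/
def vertex (K : AbstractSimplicialComplex V) (x : V) : Realization K :=
  ofSubset (Finsupp.single x 1)
    (by intro y; classical rw [Finsupp.single_apply]; split_ifs <;> norm_num)
    (by simp)
    ⟨{x}, K.singleton_mem x, by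
      intro y hy
      simpa using Finsupp.support_single_subset hy⟩

/-- The map of realizations induced by a simplicial map (affine on each simplex). -/
def mapFun (φ : SimplicialMap K L) (t : Realization K) : Realization L :=
  ofSubset (Finsupp.mapDomain φ.onVertices t.weight)
    (by
      classical
      intro y
      rw [Finsupp.mapDomain, Finsupp.sum_apply]
      refine Finset.sum_nonneg fun x _ => ?_
      beta_reduce
      rw [Finsupp.single_apply]
      split_ifs
      · exact t.nonneg x
      · exact le_rfl)
    (by
      rw [Finsupp.sum_mapDomain_index (by simp) (by simp)]
      exact t.sum_eq_one)
    (by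
      classical
      obtain ⟨τ, hτ, h⟩ := φ.map_face _ t.support_mem
      refine ⟨τ, hτ, fun y hy => ?_⟩
      have := Finsupp.mapDomain_support hy
      simp only [Finset.mem_image] at this
      obtain ⟨x, hx, rfl⟩ := this
      exact h x hx)

theorem continuous_mapFun (φ : SimplicialMap K L) : Continuous (mapFun φ) := by
  refine continuous_iSup_dom.2 fun σ => continuous_coinduced_dom.2 ?_
  obtain ⟨τ, hτ, h⟩ := φ.map_face σ.1 σ.2
  have key : mapFun φ ∘ faceMap σ = faceMap (⟨τ, hτ⟩ : L.faces) ∘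
      stdSimplex.map (fun x : σ.1 => (⟨φ.onVertices x.1, h x.1 x.2⟩ : τ)) := by
    funext t
    apply Realization.ext
    change Finsupp.mapDomain _ (Finsupp.mapDomain _ _) = Finsupp.mapDomain _ _
    rw [← Finsupp.mapDomain_comp]
    have : Finsupp.equivFunOnFinite.symm
        (stdSimplex.map (fun x : σ.1 => (⟨φ.onVertices x.1, h x.1 x.2⟩ : τ)) t : τ → ℝ) =
        Finsupp.mapDomain (fun x : σ.1 => (⟨φ.onVertices x.1, h x.1 x.2⟩ : τ))
          (Finsupp.equivFunOnFinite.symm (t : σ.1 → ℝ)) := by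
      ext y
      rfl
    rw [this, ← Finsupp.mapDomain_comp]
    rfl
  change Continuous (mapFun φ ∘ faceMap σ)
  rw [key]
  exact (continuous_faceMap _).comp (stdSimplex.continuous_map _)

/-- The continuous map of realizations induced by a simplicial map. -/
def map (φ : SimplicialMap K L) : C(Realization K, Realization L) :=
  ⟨mapFun φ, continuous_mapFun φ⟩

theorem map_vertex (φ : SimplicialMap K L) {x : V} {y : W} (h : φ.onVertices x = y) :
    map φ (vertex K x) = vertex L y := by
  subst h
  apply Realization.ext
  exact Finsupp.mapDomain_single

theorem map_id (t : Realization K) : map (SimplicialMap.id K) t = t := by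
  apply Realization.ext
  exact Finsupp.mapDomain_id

theorem map_comp {V₃ : Type*} {M : AbstractSimplicialComplex V₃} (ψ : SimplicialMap L M)
    (φ : SimplicialMap K L) (t : Realization K) : map (ψ.comp φ) t = map ψ (map φ t) := by
  apply Realization.ext
  exact Finsupp.mapDomain_comp (v := t.weight) (f := φ.onVertices) (g := ψ.onVertices)

end Realization

/-- Two vertices span a (possibly degenerate) edge of `K` if they lie in a common simplex. -/
def SpanEdge {V : Type u} (K : AbstractSimplicialComplex V) (x y : V) : Prop :=
  ∃ σ ∈ K.faces, x ∈ σ ∧ y ∈ σ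

/-- The straight path `t ↦ (1 - t) x + t y` in the realization along an edge. -/
def Realization.edgePath {V : Type u} {K : AbstractSimplicialComplex V} {x y : V}
    (h : SpanEdge K x y) : Path (Realization.vertex K x) (Realization.vertex K y) where
  toFun t := Realization.ofSubset
    (Finsupp.single x (1 - (t : ℝ)) + Finsupp.single y (t : ℝ))
    (by
      classical
      intro z
      have h0 := t.2.1
      have h1 := t.2.2
      rw [Finsupp.add_apply, Finsupp.single_apply, Finsupp.single_apply]
      split_ifs <;> linarith)
    (by
      classical
      rw [Finsupp.sum_add_index' (by simp) (by simp), Finsupp.sum_single_index rfl,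
        Finsupp.sum_single_index rfl, sub_add_cancel])
    (by
      classical
      obtain ⟨σ, hσ, hx, hy⟩ := h
      refine ⟨σ, hσ, fun z hz => ?_⟩
      rcases Finset.mem_union.1 (Finsupp.support_add hz) with hz | hz
      · have := Finsupp.support_single_subset hz
        rw [Finset.mem_singleton] at this
        exact this ▸ hx
      · have := Finsupp.support_single_subset hz
        rw [Finset.mem_singleton] at this
        exact this ▸ hy)
  continuous_toFun := by
    classical
    obtain ⟨σ, hσ, hx, hy⟩ := h
    let c : unitInterval → stdSimplex ℝ σ := fun t =>
      ⟨fun z => Pi.single (M := fun _ : σ => ℝ) ⟨x, hx⟩ (1 - (t : ℝ)) z +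
        Pi.single (M := fun _ : σ => ℝ) ⟨y, hy⟩ (t : ℝ) z, by
        have h0 := t.2.1
        have h1 := t.2.2
        constructor
        · intro z
          simp only [Pi.single_apply]
          split_ifs <;> linarith
        · rw [Finset.sum_add_distrib]
          simp⟩
    have hc : Continuous c := by
      refine Continuous.subtype_mk (continuous_pi fun z => ?_) _
      simp only [Pi.single_apply]
      refine Continuous.add ?_ ?_ <;> split_ifs <;> fun_prop
    have := (Realization.continuous_faceMap (⟨σ, hσ⟩ : K.faces)).comp hc
    convert! this using 1
    funext t
    apply Realization.ext
    change _ = Finsupp.mapDomain _ _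
    have h2 : Finsupp.equivFunOnFinite.symm (c t : σ → ℝ) =
        Finsupp.single ⟨x, hx⟩ (1 - (t : ℝ)) + Finsupp.single ⟨y, hy⟩ (t : ℝ) := by
      ext z
      rw [Finsupp.add_apply, Finsupp.single_eq_pi_single, Finsupp.single_eq_pi_single]
      rfl
    rw [h2, Finsupp.mapDomain_add, Finsupp.mapDomain_single, Finsupp.mapDomain_single]
    rfl
  source' := by
    apply Realization.ext
    change Finsupp.single x (1 - ((0 : unitInterval) : ℝ)) +
      Finsupp.single y ((0 : unitInterval) : ℝ) = Finsupp.single x 1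
    simp
  target' := by
    apply Realization.ext
    change Finsupp.single x (1 - ((1 : unitInterval) : ℝ)) +
      Finsupp.single y ((1 : unitInterval) : ℝ) = Finsupp.single y 1
    simp

/-! ### The fundamental group of a simplicial complex -/

/-- The fundamental group of (the realization of) `K` based at the vertex `b`. -/
abbrev Pi1 {V : Type u} (K : AbstractSimplicialComplex V) (b : V) : Type u :=
  FundamentalGroup (Realization K) (Realization.vertex K b)

/-- The homomorphism of fundamental groups induced by a basepoint preserving simplicial map. -/
def Pi1.map {V : Type u} {W : Type v} {K : AbstractSimplicialComplex V}
    {L : AbstractSimplicialComplex W} (φ : SimplicialMap K L) {b : V} {c : W}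
    (h : φ.onVertices b = c) : Pi1 K b →* Pi1 L c :=
  FundamentalGroup.mapOfEq (Realization.map φ) (Realization.map_vertex φ h)

theorem Pi1.map_id {V : Type u} {K : AbstractSimplicialComplex V} {b : V} :
    Pi1.map (SimplicialMap.id K) (rfl : b = b) = MonoidHom.id (Pi1 K b) := by
  ext γ
  change FundamentalGroup.mapOfEq _ _ γ = γ
  rw [FundamentalGroup.mapOfEq_apply]
  induction γ using Path.Homotopic.Quotient.ind with
  | mk p =>
    rw [← Path.Homotopic.Quotient.mk_map, ← Path.Homotopic.Quotient.mk_cast]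
    exact congrArg _ (Path.ext (funext fun t => Realization.map_id (p t)))

theorem Pi1.map_comp {V₁ V₂ V₃ : Type*} {K : AbstractSimplicialComplex V₁}
    {L : AbstractSimplicialComplex V₂} {M : AbstractSimplicialComplex V₃}
    (ψ : SimplicialMap L M) (φ : SimplicialMap K L) {a : V₁} {b : V₂} {c : V₃}
    (h : φ.onVertices a = b) (h' : ψ.onVertices b = c)
    (h'' : (ψ.comp φ).onVertices a = c) :
    Pi1.map (ψ.comp φ) h'' = (Pi1.map ψ h').comp (Pi1.map φ h) := by
  ext γ
  change FundamentalGroup.mapOfEq _ (Realization.map_vertex _ h'') γ =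
    FundamentalGroup.mapOfEq _ (Realization.map_vertex _ h')
      (FundamentalGroup.mapOfEq _ (Realization.map_vertex _ h) γ)
  rw [FundamentalGroup.mapOfEq_apply, FundamentalGroup.mapOfEq_apply,
    FundamentalGroup.mapOfEq_apply]
  induction γ using Path.Homotopic.Quotient.ind with
  | mk p =>
    rw [← Path.Homotopic.Quotient.mk_map, ← Path.Homotopic.Quotient.mk_map,
      ← Path.Homotopic.Quotient.mk_cast, ← Path.Homotopic.Quotient.mk_cast,
      ← Path.Homotopic.Quotient.mk_map, ← Path.Homotopic.Quotient.mk_cast]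
    exact congrArg _ (Path.ext (funext fun t => Realization.map_comp ψ φ (p t)))

/-! ### First simplicial homology with coefficients -/

/-- Ordered `n`-simplices of `K`: tuples of vertices (repetitions allowed) lying in a simplex. -/
def OrderedSimplex {V : Type u} (K : AbstractSimplicialComplex V) (n : ℕ) : Type u :=
  {x : Fin (n + 1) → V // ∃ σ ∈ K.faces, ∀ i, x i ∈ σ}

namespace OrderedSimplex

variable {V : Type u} {W : Type v} {K : AbstractSimplicialComplex V}
  {L : AbstractSimplicialComplex W}

/-- The `i`-th face of an ordered simplex, obtained by omitting the `i`-th vertex. -/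
def face {n : ℕ} (x : OrderedSimplex K (n + 1)) (i : Fin (n + 2)) : OrderedSimplex K n :=
  ⟨fun j => x.1 (i.succAbove j), by
    obtain ⟨σ, hσ, h⟩ := x.2
    exact ⟨σ, hσ, fun j => h _⟩⟩

/-- The image of an ordered simplex under a simplicial map. -/
def map {n : ℕ} (φ : SimplicialMap K L) (x : OrderedSimplex K n) : OrderedSimplex L n :=
  ⟨fun j => φ.onVertices (x.1 j), by
    obtain ⟨σ, hσ, h⟩ := x.2
    obtain ⟨τ, hτ, h'⟩ := φ.map_face σ hσ
    exact ⟨τ, hτ, fun j => h' _ (h j)⟩⟩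

/-- The ordered `1`-simplex `(x, y)`. -/
def edge {x y : V} (h : SpanEdge K x y) : OrderedSimplex K 1 :=
  ⟨![x, y], by
    obtain ⟨σ, hσ, hx, hy⟩ := h
    refine ⟨σ, hσ, fun i => ?_⟩
    fin_cases i
    · exact hx
    · exact hy⟩

/-- The ordered `0`-simplex `(x)`. -/
def point (K : AbstractSimplicialComplex V) (x : V) : OrderedSimplex K 0 :=
  ⟨fun _ => x, {x}, K.singleton_mem x, fun _ => Finset.mem_singleton_self x⟩

end OrderedSimplex

section Homology

variable {V : Type u} {W : Type v} {K : AbstractSimplicialComplex V}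
  {L : AbstractSimplicialComplex W}

/-- The simplicial `n`-chains of `K` with coefficients in `G`. -/
abbrev SimplicialChain (K : AbstractSimplicialComplex V) (G : Type w) [AddCommGroup G] (n : ℕ) :
    Type (max u w) :=
  OrderedSimplex K n →₀ G

/-- The boundary `∂(g · x) = ∑ᵢ (-1)ⁱ g · (i-th face of x)`. -/
def simplicialBoundary (K : AbstractSimplicialComplex V) (G : Type w) [AddCommGroup G] (n : ℕ) :
    SimplicialChain K G (n + 1) →+ SimplicialChain K G n :=
  Finsupp.liftAddHom fun x =>
    ∑ i : Fin (n + 2), ((-1 : ℤ) ^ (i : ℕ)) • Finsupp.singleAddHom (x.face i)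

/-- The chain map induced by a simplicial map. -/
def simplicialChainMap (φ : SimplicialMap K L) (G : Type w) [AddCommGroup G] (n : ℕ) :
    SimplicialChain K G n →+ SimplicialChain L G n :=
  Finsupp.mapDomain.addMonoidHom (OrderedSimplex.map φ)

theorem simplicialBoundary_chainMap (φ : SimplicialMap K L) (G : Type w) [AddCommGroup G] (n : ℕ)
    (c : SimplicialChain K G (n + 1)) :
    simplicialBoundary L G n (simplicialChainMap φ G (n + 1) c) =
      simplicialChainMap φ G n (simplicialBoundary K G n c) := by
  have : (simplicialBoundary L G n).comp (simplicialChainMap φ G (n + 1)) =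
      (simplicialChainMap φ G n).comp (simplicialBoundary K G n) := by
    refine Finsupp.addHom_ext fun x g => ?_
    simp only [AddMonoidHom.comp_apply, simplicialChainMap, Finsupp.mapDomain.addMonoidHom_apply,
      Finsupp.mapDomain_single, simplicialBoundary, Finsupp.liftAddHom_apply_single,
      AddMonoidHom.finsetSum_apply, AddMonoidHom.smul_apply, Finsupp.singleAddHom_apply]
    rw [← Finsupp.mapDomain.addMonoidHom_apply, map_sum]
    refine Finset.sum_congr rfl fun i _ => ?_
    rw [map_zsmul, Finsupp.mapDomain.addMonoidHom_apply, Finsupp.mapDomain_single]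
    rfl
  exact DFunLike.congr_fun this c

theorem simplicialBoundary_boundary (K : AbstractSimplicialComplex V) (G : Type w)
    [AddCommGroup G] (c : SimplicialChain K G 2) :
    simplicialBoundary K G 0 (simplicialBoundary K G 1 c) = 0 := by
  have : (simplicialBoundary K G 0).comp (simplicialBoundary K G 1) = 0 := by
    refine Finsupp.addHom_ext fun x g => ?_
    have h1 : (x.face 0).face 0 = (x.face 1).face 0 := Subtype.ext (by
      funext j; fin_cases j; rfl)
    have h2 : (x.face 0).face 1 = (x.face 2).face 0 := Subtype.ext (by
      funext j; fin_cases j; rfl)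
    have h3 : (x.face 1).face 1 = (x.face 2).face 1 := Subtype.ext (by
      funext j; fin_cases j; rfl)
    have e : ∀ (n : ℕ) (z : OrderedSimplex K (n + 1)), simplicialBoundary K G n
        (Finsupp.single z g) =
        ∑ i : Fin (n + 2), ((-1 : ℤ) ^ (i : ℕ)) • Finsupp.single (z.face i) g := by
      intro n z
      simp [simplicialBoundary]
    rw [AddMonoidHom.comp_apply, e, map_sum]
    simp only [map_zsmul, e, Fin.sum_univ_succ, Fin.sum_univ_zero]
    simp [h1, h2, h3]
    abel
  exact DFunLike.congr_fun this c

/-- The `1`-cycles of `K`. -/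
abbrev cycles1 (K : AbstractSimplicialComplex V) (G : Type w) [AddCommGroup G] :
    AddSubgroup (SimplicialChain K G 1) :=
  (simplicialBoundary K G 0).ker

/-- The `1`-boundaries of `K`, as a subgroup of the group of `1`-cycles. -/
abbrev boundaries1 (K : AbstractSimplicialComplex V) (G : Type w) [AddCommGroup G] :
    AddSubgroup (cycles1 K G) :=
  (simplicialBoundary K G 1).range.addSubgroupOf (cycles1 K G)

/-- The first simplicial homology group `H₁(K; G)`. -/
abbrev H1 (K : AbstractSimplicialComplex V) (G : Type w) [AddCommGroup G] : Type (max u w) :=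
  cycles1 K G ⧸ boundaries1 K G

/-- The map of `1`-cycles induced by a simplicial map. -/
def cycles1Map (φ : SimplicialMap K L) (G : Type w) [AddCommGroup G] :
    cycles1 K G →+ cycles1 L G :=
  ((simplicialChainMap φ G 1).comp (cycles1 K G).subtype).codRestrict (cycles1 L G) (fun c => by
    rw [AddMonoidHom.mem_ker]
    have h := simplicialBoundary_chainMap φ G 0 c.1
    rw [AddMonoidHom.mem_ker.1 c.2, map_zero] at h
    exact h)

/-- The homomorphism of first homology groups induced by a simplicial map. -/
def H1.map (φ : SimplicialMap K L) (G : Type w) [AddCommGroup G] : H1 K G →+ H1 L G :=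
  QuotientAddGroup.map _ _ (cycles1Map φ G) (by
    rintro c ⟨d, hd⟩
    refine ⟨simplicialChainMap φ G 2 d, ?_⟩
    rw [simplicialBoundary_chainMap, hd]
    rfl)

theorem H1.map_id (G : Type w) [AddCommGroup G] :
    H1.map (SimplicialMap.id K) G = AddMonoidHom.id (H1 K G) := by
  refine QuotientAddGroup.addMonoidHom_ext _ (AddMonoidHom.ext fun c => ?_)
  change QuotientAddGroup.mk (cycles1Map _ G c) = QuotientAddGroup.mk c
  congr 1
  apply Subtype.ext
  exact Finsupp.mapDomain_id

theorem H1.map_comp {V₃ : Type*} {M : AbstractSimplicialComplex V₃} (ψ : SimplicialMap L M)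
    (φ : SimplicialMap K L) (G : Type w) [AddCommGroup G] :
    H1.map (ψ.comp φ) G = (H1.map ψ G).comp (H1.map φ G) := by
  refine QuotientAddGroup.addMonoidHom_ext _ (AddMonoidHom.ext fun c => ?_)
  change QuotientAddGroup.mk (cycles1Map _ G c) =
    QuotientAddGroup.mk (cycles1Map _ G (cycles1Map _ G c))
  congr 1
  apply Subtype.ext
  exact Finsupp.mapDomain_comp (v := c.1) (f := OrderedSimplex.map φ) (g := OrderedSimplex.map ψ)

end Homology

/-! ### Simplicial loops -/

/-- A simplicial loop in `K` based at `b`: a sequence `b = x₀, x₁, …, xₙ = b` of vertices such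
that consecutive ones lie in a common simplex. Values of `pt` beyond `size` are irrelevant. -/
structure SimplicialLoop {V : Type u} (K : AbstractSimplicialComplex V) (b : V) where
  size : ℕ
  pt : ℕ → V
  pt_zero : pt 0 = b
  pt_size : pt size = b
  edge : ∀ i < size, SpanEdge K (pt i) (pt (i + 1))

/-- The concatenation of the edges of a sequence of vertices, as a path in the realization. -/
def Realization.seqPath {V : Type u} {K : AbstractSimplicialComplex V} (x : ℕ → V) :
    (n : ℕ) → (∀ i < n, SpanEdge K (x i) (x (i + 1))) →
      Path (Realization.vertex K (x 0)) (Realization.vertex K (x n))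
  | 0, _ => Path.refl _
  | n + 1, h => (Realization.seqPath x n fun i hi => h i (Nat.lt_succ_of_lt hi)).trans
      (Realization.edgePath (h n (Nat.lt_succ_self n)))

namespace SimplicialLoop

variable {V : Type u} {K : AbstractSimplicialComplex V} {b : V}

/-- The class of a simplicial loop in the fundamental group. -/
def classPi1 (ℓ : SimplicialLoop K b) : Pi1 K b :=
  FundamentalGroup.fromPath (Path.Homotopic.Quotient.mk
    ((Realization.seqPath ℓ.pt ℓ.size ℓ.edge).cast
      (congrArg (Realization.vertex K) ℓ.pt_zero.symm)
      (congrArg (Realization.vertex K) ℓ.pt_size.symm)))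

/-- The chain `g · ((x₀, x₁) + (x₁, x₂) + ⋯ + (xₙ₋₁, xₙ))` of a simplicial loop. -/
def chain (ℓ : SimplicialLoop K b) {G : Type w} [AddCommGroup G] (g : G) : SimplicialChain K G 1 :=
  ∑ i : Fin ℓ.size, Finsupp.single (OrderedSimplex.edge (ℓ.edge i i.2)) g

theorem boundary_chain (ℓ : SimplicialLoop K b) {G : Type w} [AddCommGroup G] (g : G) :
    simplicialBoundary K G 0 (ℓ.chain g) = 0 := by
  have h : ∀ i : Fin ℓ.size, simplicialBoundary K G 0
      (Finsupp.single (OrderedSimplex.edge (ℓ.edge i i.2)) g) =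
      Finsupp.single (OrderedSimplex.point K (ℓ.pt (i + 1))) g -
        Finsupp.single (OrderedSimplex.point K (ℓ.pt i)) g := by
    intro i
    have h0 : (OrderedSimplex.edge (ℓ.edge i i.2)).face 0 =
        OrderedSimplex.point K (ℓ.pt (i + 1)) := Subtype.ext (by funext j; fin_cases j; rfl)
    have h1 : (OrderedSimplex.edge (ℓ.edge i i.2)).face 1 =
        OrderedSimplex.point K (ℓ.pt i) := Subtype.ext (by funext j; fin_cases j; rfl)
    simp [simplicialBoundary, Fin.sum_univ_succ, h0, h1, sub_eq_add_neg]
  rw [chain, map_sum, Finset.sum_congr rfl fun i _ => h i,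
    Fin.sum_univ_eq_sum_range (fun i => Finsupp.single (OrderedSimplex.point K (ℓ.pt (i + 1))) g -
        Finsupp.single (OrderedSimplex.point K (ℓ.pt i)) g) ℓ.size,
    Finset.sum_range_sub (fun i => Finsupp.single (OrderedSimplex.point K (ℓ.pt i)) g),
    ℓ.pt_zero, ℓ.pt_size, sub_self]

/-- The class of `g` times a simplicial loop in `H₁(K; G)`. -/
def classH1 (ℓ : SimplicialLoop K b) {G : Type w} [AddCommGroup G] (g : G) : H1 K G :=
  QuotientAddGroup.mk ⟨ℓ.chain g, AddMonoidHom.mem_ker.2 (ℓ.boundary_chain g)⟩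

end SimplicialLoop

/-! ### Rips complexes and their persistence -/

/-- The scales `r > 0`. -/
abbrev Scale : Type := Set.Ioi (0 : ℝ)

/-- The scale `r + δ`. -/
def Scale.add (r : Scale) (δ : ℝ≥0) : Scale :=
  ⟨r.1 + δ, add_pos_of_pos_of_nonneg r.2 δ.2⟩

theorem Scale.le_add (r : Scale) (δ : ℝ≥0) : r ≤ r.add δ :=
  Subtype.coe_le_coe.1 (le_add_of_nonneg_right δ.2)

theorem Scale.add_le_add {r r' : Scale} (h : r ≤ r') (δ : ℝ≥0) :
    r.add δ ≤ r'.add δ :=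
  Subtype.coe_le_coe.1 (add_le_add_left (Subtype.coe_le_coe.2 h) (δ : ℝ))

/-- The open Rips complex: simplices are the finite nonempty sets of diameter less than `r`. -/
def rips (Y : Type u) [MetricSpace Y] (r : Scale) : AbstractSimplicialComplex Y where
  faces := {σ | σ.Nonempty ∧ Metric.diam (σ : Set Y) < r}
  isRelLowerSet_faces := by
    intro σ hσ
    exact ⟨hσ.1, fun τ hτ hne => ⟨hne, (Metric.diam_mono (Finset.coe_subset.2 hτ)
      σ.finite_toSet.isBounded).trans_lt hσ.2⟩⟩
  singleton_mem x := ⟨Finset.singleton_nonempty x, by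
    rw [Finset.coe_singleton, Metric.diam_singleton]; exact r.2⟩

theorem spanEdge_rips_iff {Y : Type u} [MetricSpace Y] {r : Scale} {x y : Y} :
    SpanEdge (rips Y r) x y ↔ dist x y < r := by
  classical
  constructor
  · rintro ⟨σ, hσ, hx, hy⟩
    exact (Metric.dist_le_diam_of_mem σ.finite_toSet.isBounded hx hy).trans_lt hσ.2
  · intro h
    refine ⟨{x, y}, ⟨⟨x, by simp⟩, ?_⟩, by simp, by simp⟩
    rw [Finset.coe_pair, Metric.diam_pair]
    exact h

/-- The bonding map `Rips(Y, p) → Rips(Y, q)`, the identity on vertices. -/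
def ripsBond (Y : Type u) [MetricSpace Y] {p q : Scale} (h : p ≤ q) :
    SimplicialMap (rips Y p) (rips Y q) where
  onVertices x := x
  map_face σ hσ := ⟨σ, ⟨hσ.1, hσ.2.trans_le (Subtype.coe_le_coe.2 h)⟩, fun _ hx => hx⟩

/-- The map `Rips(S, p) → Rips(X, p)` induced by the inclusion `S ⊆ X`. -/
def ripsIncl {X : Type u} [MetricSpace X] (S : Set X) (p : Scale) :
    SimplicialMap (rips S p) (rips X p) where
  onVertices x := x.1
  map_face σ hσ := by
    classical
    refine ⟨σ.image Subtype.val, ⟨hσ.1.image _, ?_⟩, fun x hx => Finset.mem_image_of_mem _ hx⟩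
    rw [Finset.coe_image, isometry_subtype_coe.diam_image]
    exact hσ.2

/-- The persistence `{π₁(Rips(Y, r), b)}_{r > 0}`. -/
def persPi1 (Y : Type u) [MetricSpace Y] (b : Y) : Scale ⥤ GrpCat.{u} where
  obj r := GrpCat.of (Pi1 (rips Y r) b)
  map h := GrpCat.ofHom (Pi1.map (ripsBond Y h.le) rfl)
  map_id r := GrpCat.hom_ext Pi1.map_id
  map_comp f g := GrpCat.hom_ext (Pi1.map_comp (ripsBond Y g.le) (ripsBond Y f.le) rfl rfl rfl)

/-- The persistence `{H₁(Rips(Y, r); G)}_{r > 0}`. -/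
def persH1 (Y : Type u) [MetricSpace Y] (G : Type w) [AddCommGroup G] :
    Scale ⥤ AddCommGrpCat.{max u w} where
  obj r := AddCommGrpCat.of (H1 (rips Y r) G)
  map h := AddCommGrpCat.ofHom (H1.map (ripsBond Y h.le) G)
  map_id r := AddCommGrpCat.hom_ext (H1.map_id G)
  map_comp f g := AddCommGrpCat.hom_ext (H1.map_comp (ripsBond Y g.le) (ripsBond Y f.le) G)

/-- `μ_p` on fundamental groups. -/
def muPi1 {X : Type u} [MetricSpace X] (S : Set X) (b : S) (p : Scale) :
    (persPi1 S b).obj p ⟶ (persPi1 X (b : X)).obj p :=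
  GrpCat.ofHom (Pi1.map (ripsIncl S p) rfl)

/-- `μ_p` on first homology groups. -/
def muH1 {X : Type u} [MetricSpace X] (S : Set X) (G : Type w) [AddCommGroup G] (p : Scale) :
    (persH1 S G).obj p ⟶ (persH1 X G).obj p :=
  AddCommGrpCat.ofHom (H1.map (ripsIncl S p) G)

/-- An `(a, c)`-interleaving of persistences `P` and `Q`: morphisms `f_r : P_r → Q_{r+a}` and
`g_r : Q_r → P_{r+c}` commuting with the bonding maps and with each other. -/
structure Interleaving {C : Type*} [Category C] (a c : ℝ≥0)
    (P Q : Scale ⥤ C) where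
  f : ∀ r : Scale, P.obj r ⟶ Q.obj (r.add a)
  g : ∀ r : Scale, Q.obj r ⟶ P.obj (r.add c)
  f_bond : ∀ (r r' : Scale) (h : r ≤ r'),
    P.map (homOfLE h) ≫ f r' = f r ≫ Q.map (homOfLE (Scale.add_le_add h a))
  g_bond : ∀ (r r' : Scale) (h : r ≤ r'),
    Q.map (homOfLE h) ≫ g r' = g r ≫ P.map (homOfLE (Scale.add_le_add h c))
  f_g : ∀ r : Scale, f r ≫ g (r.add a) =
    P.map (homOfLE ((r.le_add a).trans ((r.add a).le_add c)))
  g_f : ∀ r : Scale, g r ≫ f (r.add c) =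
    Q.map (homOfLE ((r.le_add c).trans ((r.add c).le_add a)))

/-! ### Moving loops to the sample -/

/-- A choice of sample points `yᵢ ∈ S` with `d(xᵢ, yᵢ) < s` for a simplicial loop
`b = x₀, …, xₙ = b`, equal to `b` at both ends. -/
structure SampleChoice {X : Type u} [MetricSpace X] (S : Set X) (s : ℝ≥0) (b : S) {p : Scale}
    (ℓ : SimplicialLoop (rips X p) (b : X)) where
  y : ℕ → S
  y_zero : y 0 = b
  y_size : y ℓ.size = b
  near : ∀ i ≤ ℓ.size, dist (ℓ.pt i) (y i) < s

/-- The simplicial loop `b = y₀, …, yₙ = b` in `Rips(S, p + 2s)` given by a choice of sample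
points. -/
def SampleChoice.loop {X : Type u} [MetricSpace X] {S : Set X} {s : ℝ≥0} {b : S} {p : Scale}
    {ℓ : SimplicialLoop (rips X p) (b : X)} (y : SampleChoice S s b ℓ) :
    SimplicialLoop (rips S (p.add (2 * s))) b where
  size := ℓ.size
  pt := y.y
  pt_zero := y.y_zero
  pt_size := y.y_size
  edge i hi := by
    rw [spanEdge_rips_iff]
    have h1 := y.near i hi.le
    have h2 := y.near (i + 1) hi
    have h3 := spanEdge_rips_iff.1 (ℓ.edge i hi)
    have h4 := dist_triangle4 (y.y i : X) (ℓ.pt i) (ℓ.pt (i + 1)) (y.y (i + 1))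
    rw [dist_comm (y.y i : X) (ℓ.pt i)] at h4
    change dist (y.y i : X) (y.y (i + 1)) < (p : ℝ) + ((2 * s : ℝ≥0) : ℝ)
    push_cast
    linarith

/-- `γ ↦ δ` in the construction of `ν_p` on fundamental groups: `γ` is the class of a `p`-loop and
`δ` is the class of a loop of nearby sample points. -/
def NuRelPi1 {X : Type u} [MetricSpace X] (S : Set X) (s : ℝ≥0) (b : S) (p : Scale)
    (γ : Pi1 (rips X p) (b : X)) (δ : Pi1 (rips S (p.add (2 * s))) b) : Prop :=
  ∃ (ℓ : SimplicialLoop (rips X p) (b : X)) (y : SampleChoice S s b ℓ),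
    ℓ.classPi1 = γ ∧ y.loop.classPi1 = δ

/-- `γ ↦ δ` in the construction of `ν_p` on homology: `γ` is a finite sum of classes `gⱼ [Lⱼ]` of
based `p`-loops and `δ` is the sum of the classes `gⱼ [L'ⱼ]` for loops `L'ⱼ` of nearby sample
points. -/
def NuRelH1 {X : Type u} [MetricSpace X] (S : Set X) (s : ℝ≥0) (b : S)
    (G : Type w) [AddCommGroup G] (p : Scale)
    (γ : H1 (rips X p) G) (δ : H1 (rips S (p.add (2 * s))) G) : Prop :=
  ∃ (m : ℕ) (g : Fin m → G) (ℓ : Fin m → SimplicialLoop (rips X p) (b : X))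
    (y : ∀ j, SampleChoice S s b (ℓ j)),
    ∑ j, (ℓ j).classH1 (g j) = γ ∧ ∑ j, (y j).loop.classH1 (g j) = δ

end

/-! Move every point of `X` to a sample point at distance less than `s`, leaving `S` fixed. By the
triangle inequality, distances grow by less than `2 * s`. The vertex map `samplePoint` is therefore
simplicial from `Rips(X, p)` to `Rips(S, p + 2s)`, and `ν` is the map it induces.

Everything else is contiguity: if corresponding edges of two based loops of equal length span common
simplices, the loops have the same class in π₁ (`Contiguous.classPi1_eq`) and in H₁
(`Contiguous.classH1_eq`). Any two choices of sample points for a loop are contiguous at scale `p +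
2s`, which gives independence of the choice. A loop is also contiguous there to its own sampled
loop, which gives `μ ∘ ν`. The composite `ν ∘ μ` and the commutation with bonding maps already hold
on vertices.

Evaluating on loops suffices because loops exhaust both groups. In π₁ this is simplicial
approximation by open stars (`classPi1_surjective`). In H₁, a cycle in a connected complex is a sum
of based loops, obtained by joining its edges to the base point (`H1.exists_sum_classH1`); the
geodesic hypothesis supplies connectedness. -/

noncomputable section

namespace Realization

variable {V : Type u} {W : Type v} {K : AbstractSimplicialComplex V}
  {L : AbstractSimplicialComplex W}

/-! ### Straight paths inside closed simplices -/

/-- Every point of the realization whose support lies in a face comes from that closed simplex. -/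
theorem exists_faceMap_eq (σ : K.faces) (z : Realization K) (hz : z.weight.support ⊆ σ.1) :
    ∃ a : stdSimplex ℝ σ.1, faceMap σ a = z := by
  classical
  refine ⟨⟨fun x => z.weight x.1, fun x => z.nonneg _, ?_⟩, ?_⟩
  · rw [Finset.sum_coe_sort σ.1 fun x => z.weight x, ← z.sum_eq_one, Finsupp.sum]
    refine (Finset.sum_subset hz fun x _ hx => ?_).symm
    simpa using hx
  · apply Realization.ext
    ext x
    change Finsupp.mapDomain _ _ x = _
    by_cases hx : x ∈ σ.1
    · exact Finsupp.mapDomain_apply (f := (Subtype.val : σ.1 → V)) Subtype.val_injective _ ⟨x, hx⟩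
    · rw [Finsupp.mapDomain_of_notMem_range _ _ (by simpa using hx)]
      exact (Finsupp.notMem_support_iff.1 fun h => hx (hz h)).symm

theorem faceMap_apply_of_mem (σ : K.faces) (a : stdSimplex ℝ σ.1) {x : V} (hx : x ∈ σ.1) :
    (faceMap σ a).weight x = a ⟨x, hx⟩ :=
  Finsupp.mapDomain_apply (f := (Subtype.val : σ.1 → V)) Subtype.val_injective _ ⟨x, hx⟩

theorem faceMap_apply_of_notMem (σ : K.faces) (a : stdSimplex ℝ σ.1) {x : V} (hx : x ∉ σ.1) :
    (faceMap σ a).weight x = 0 :=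
  Finsupp.mapDomain_of_notMem_range _ _ (by simpa using hx)

theorem support_faceMap_subset (σ : K.faces) (a : stdSimplex ℝ σ.1) :
    (faceMap σ a).weight.support ⊆ σ.1 := by
  intro x hx
  by_contra h
  exact Finsupp.mem_support_iff.1 hx (faceMap_apply_of_notMem σ a h)

/-- Two points of the realization lie in a common closed simplex. -/
def Cofacial (z w : Realization K) : Prop :=
  ∃ σ ∈ K.faces, z.weight.support ⊆ σ ∧ w.weight.support ⊆ σ

/-- The point `(1 - t) z + t w` of a closed simplex containing `z` and `w`. -/
def linePoint {z w : Realization K} (h : Cofacial z w) (t : unitInterval) : Realization K :=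
  ofSubset ((1 - (t : ℝ)) • z.weight + (t : ℝ) • w.weight)
    (fun x => by
      rw [Finsupp.add_apply, Finsupp.smul_apply, Finsupp.smul_apply, smul_eq_mul, smul_eq_mul]
      exact add_nonneg (mul_nonneg (sub_nonneg.2 t.2.2) (z.nonneg x))
        (mul_nonneg t.2.1 (w.nonneg x)))
    (by
      classical
      rw [Finsupp.sum_add_index' (by simp) (by simp), Finsupp.sum_smul_index (by simp),
        Finsupp.sum_smul_index (by simp), ← Finsupp.mul_sum, ← Finsupp.mul_sum,
        z.sum_eq_one, w.sum_eq_one]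
      ring)
    (by
      classical
      obtain ⟨σ, hσ, hz, hw⟩ := h
      refine ⟨σ, hσ, fun x hx => ?_⟩
      rcases Finset.mem_union.1 (Finsupp.support_add hx) with hx | hx
      · exact hz (Finsupp.support_smul hx)
      · exact hw (Finsupp.support_smul hx))

/-- The straight path between two points of a standard simplex. -/
def simplexLine {ι : Type*} [Fintype ι] (a c : stdSimplex ℝ ι) : Path a c where
  toFun t := ⟨(1 - (t : ℝ)) • (a : ι → ℝ) + (t : ℝ) • (c : ι → ℝ),
    convex_stdSimplex ℝ ι a.2 c.2 (sub_nonneg.2 t.2.2) t.2.1 (by ring)⟩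
  continuous_toFun := by
    refine Continuous.subtype_mk ?_ _
    fun_prop
  source' := by
    apply Subtype.ext
    change (1 - (0 : ℝ)) • (a : ι → ℝ) + (0 : ℝ) • (c : ι → ℝ) = a
    simp
  target' := by
    apply Subtype.ext
    change (1 - (1 : ℝ)) • (a : ι → ℝ) + (1 : ℝ) • (c : ι → ℝ) = c
    simp

/-- The inclusion of a closed simplex is affine. Continuity and homotopy of straight paths can thus
be treated in the standard simplex, with its Euclidean topology. -/
theorem linePoint_faceMap (σ : K.faces) (a c : stdSimplex ℝ σ.1)
    (h : Cofacial (faceMap σ a) (faceMap σ c)) (t : unitInterval) :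
    linePoint h t = faceMap σ (simplexLine a c t) := by
  apply Realization.ext
  ext x
  change (1 - (t : ℝ)) * (faceMap σ a).weight x + (t : ℝ) * (faceMap σ c).weight x = _
  by_cases hx : x ∈ σ.1
  · simp only [faceMap_apply_of_mem σ _ hx]
    rfl
  · simp [faceMap_apply_of_notMem σ _ hx]

/-- The straight path between two points of a common closed simplex. -/
def linePath {z w : Realization K} (h : Cofacial z w) : Path z w where
  toFun := linePoint h
  continuous_toFun := by
    obtain ⟨σ, hσ, hz, hw⟩ := id h
    obtain ⟨a, rfl⟩ := exists_faceMap_eq ⟨σ, hσ⟩ z hz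
    obtain ⟨c, rfl⟩ := exists_faceMap_eq ⟨σ, hσ⟩ w hw
    rw [funext (linePoint_faceMap ⟨σ, hσ⟩ a c h)]
    exact (continuous_faceMap _).comp (simplexLine a c).continuous
  source' := by
    apply Realization.ext
    change (1 - (0 : ℝ)) • z.weight + (0 : ℝ) • w.weight = _
    simp
  target' := by
    apply Realization.ext
    change (1 - (1 : ℝ)) • z.weight + (1 : ℝ) • w.weight = _
    simp

theorem linePath_faceMap (σ : K.faces) (a c : stdSimplex ℝ σ.1)
    (h : Cofacial (faceMap σ a) (faceMap σ c)) :
    linePath h = (simplexLine a c).map (continuous_faceMap σ) :=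
  Path.ext (funext (linePoint_faceMap σ a c h))

instance {ι : Type*} [Fintype ι] [Nonempty ι] : ContractibleSpace (stdSimplex ℝ ι) := by
  classical
  exact (convex_stdSimplex ℝ ι).contractibleSpace
    ⟨_, single_mem_stdSimplex ℝ (Classical.arbitrary ι)⟩

/-- Going around a triangle inside a closed simplex. -/
theorem linePath_trans {z w x : Realization K} {σ : Finset V} (hσ : σ ∈ K.faces)
    (hz : z.weight.support ⊆ σ) (hw : w.weight.support ⊆ σ) (hx : x.weight.support ⊆ σ)
    (h₁ : Cofacial z w) (h₂ : Cofacial w x) (h₃ : Cofacial z x) :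
    ((linePath h₁).trans (linePath h₂)).Homotopic (linePath h₃) := by
  have : Nonempty σ := (K.isRelLowerSet_faces hσ).1.to_subtype
  obtain ⟨a, rfl⟩ := exists_faceMap_eq ⟨σ, hσ⟩ z hz
  obtain ⟨c, rfl⟩ := exists_faceMap_eq ⟨σ, hσ⟩ w hw
  obtain ⟨d, rfl⟩ := exists_faceMap_eq ⟨σ, hσ⟩ x hx
  -- All three segments come from the standard simplex, which is contractible, hence simply
  -- connected.
  rw [linePath_faceMap, linePath_faceMap, linePath_faceMap, ← Path.map_trans]
  exact Path.Homotopic.map (SimplyConnectedSpace.paths_homotopic _ _)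
    ⟨_, continuous_faceMap (⟨σ, hσ⟩ : K.faces)⟩

/-- Paths whose endpoints are only propositionally equal have different types, so the comparison is
made on values. -/
theorem linePath_apply_congr {z z' w : Realization K} (e : z = z') (h : Cofacial z w)
    (h' : Cofacial z' w) (t : unitInterval) : linePath h t = linePath h' t := by
  subst e
  rfl

theorem linePath_self {z : Realization K} (h : Cofacial z z) : linePath h = Path.refl z := by
  refine Path.ext (funext fun t => Realization.ext ?_)
  change (1 - (t : ℝ)) • z.weight + (t : ℝ) • z.weight = z.weight
  rw [← add_smul, sub_add_cancel, one_smul]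

theorem support_vertex (K : AbstractSimplicialComplex V) (x : V) :
    (vertex K x).weight.support = {x} :=
  Finsupp.support_single x one_ne_zero

theorem support_vertex_subset {σ : Finset V} {x : V} (hx : x ∈ σ) :
    (vertex K x).weight.support ⊆ σ := by
  rw [support_vertex]
  exact Finset.singleton_subset_iff.2 hx

theorem cofacial_vertex {x y : V} (h : SpanEdge K x y) :
    Cofacial (vertex K x) (vertex K y) := by
  obtain ⟨σ, hσ, hx, hy⟩ := h
  exact ⟨σ, hσ, support_vertex_subset hx, support_vertex_subset hy⟩

theorem edgePath_eq_linePath {x y : V} (h : SpanEdge K x y) :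
    edgePath h = linePath (cofacial_vertex h) := by
  refine Path.ext (funext fun t => Realization.ext ?_)
  change Finsupp.single x (1 - (t : ℝ)) + Finsupp.single y (t : ℝ) =
    (1 - (t : ℝ)) • Finsupp.single x 1 + (t : ℝ) • Finsupp.single y 1
  simp

theorem edgePath_trans {x y z : V} {σ : Finset V} (hσ : σ ∈ K.faces)
    (hx : x ∈ σ) (hy : y ∈ σ) (hz : z ∈ σ)
    (h₁ : SpanEdge K x y) (h₂ : SpanEdge K y z) (h₃ : SpanEdge K x z) :
    ((edgePath h₁).trans (edgePath h₂)).Homotopic (edgePath h₃) := by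
  simp only [edgePath_eq_linePath]
  exact linePath_trans hσ (support_vertex_subset hx) (support_vertex_subset hy)
    (support_vertex_subset hz) _ _ _

theorem edgePath_self {x : V} (h : SpanEdge K x x) : edgePath h = Path.refl (vertex K x) := by
  rw [edgePath_eq_linePath, linePath_self]

/-! ### Open stars -/

/-- The open star of a vertex. -/
def openStar (K : AbstractSimplicialComplex V) (x : V) : Set (Realization K) :=
  {z | 0 < z.weight x}

theorem isOpen_iff {U : Set (Realization K)} :
    IsOpen U ↔ ∀ σ : K.faces, IsOpen (faceMap σ ⁻¹' U) := by
  rw [isOpen_iSup_iff]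
  exact forall_congr' fun σ => isOpen_coinduced

theorem isOpen_openStar (x : V) : IsOpen (openStar K x) := by
  refine isOpen_iff.2 fun σ => ?_
  by_cases hx : x ∈ σ.1
  · have : faceMap σ ⁻¹' openStar K x = {a | 0 < a.1 ⟨x, hx⟩} := by
      ext a
      change 0 < (faceMap σ a).weight x ↔ _
      rw [faceMap_apply_of_mem σ a hx]
      rfl
    rw [this]
    exact isOpen_lt continuous_const ((continuous_apply _).comp continuous_subtype_val)
  · convert isOpen_empty
    ext a
    change 0 < (faceMap σ a).weight x ↔ _
    simp [faceMap_apply_of_notMem σ a hx]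

/-- Over an open `U`, relative continuity means that the sets `U ∩ f ⁻¹' O` are open, and the weak
topology tests openness on each closed simplex. -/
theorem continuousOn_of_faceMap {Z : Type*} [TopologicalSpace Z] {U : Set (Realization K)}
    (hU : IsOpen U) {f : Realization K → Z}
    (hf : ∀ σ : K.faces, ContinuousOn (f ∘ faceMap σ) (faceMap σ ⁻¹' U)) : ContinuousOn f U := by
  rw [continuousOn_open_iff hU]
  intro O hO
  refine isOpen_iff.2 fun σ => ?_
  exact (continuousOn_open_iff (isOpen_iff.1 hU σ)).1 (hf σ) O hO

theorem mem_support_of_mem_openStar {z : Realization K} {x : V} (h : z ∈ openStar K x) :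
    x ∈ z.weight.support :=
  Finsupp.mem_support_iff.2 (ne_of_gt h)

theorem cofacial_of_mem_openStar {z : Realization K} {x : V} (h : z ∈ openStar K x) :
    Cofacial z (vertex K x) :=
  ⟨_, z.support_mem, subset_rfl, support_vertex_subset (mem_support_of_mem_openStar h)⟩

theorem exists_mem_openStar (z : Realization K) : ∃ x, z ∈ openStar K x := by
  obtain ⟨x, hx⟩ := (K.isRelLowerSet_faces z.support_mem).1
  exact ⟨x, lt_of_le_of_ne (z.nonneg x) (Finsupp.mem_support_iff.1 hx).symm⟩

theorem eq_of_vertex_mem_openStar {x y : V} (h : vertex K x ∈ openStar K y) : x = y := by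
  have := mem_support_of_mem_openStar h
  rw [support_vertex] at this
  exact (Finset.mem_singleton.1 this).symm

open Classical in
/-- The straight path from a point of the open star of `x` to the vertex `x`. -/
def starContract (x : V) (z : Realization K) : C(unitInterval, Realization K) :=
  if h : z ∈ openStar K x then (linePath (cofacial_of_mem_openStar h)).toContinuousMap
  else ContinuousMap.const _ z

theorem starContract_apply {x : V} {z : Realization K} (h : z ∈ openStar K x) (t : unitInterval) :
    starContract x z t = linePath (cofacial_of_mem_openStar h) t := by
  rw [starContract, dif_pos h]
  rfl

/-- The weak topology tests continuity simplex by simplex for maps out of the realization, but not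
directly for maps out of its product with the interval. The contraction is therefore a map into the
path space; on each closed simplex it is the currying of a jointly continuous map. -/
theorem continuousOn_starContract (x : V) :
    ContinuousOn (starContract (K := K) x) (openStar K x) := by
  refine continuousOn_of_faceMap (isOpen_openStar x) fun σ => ?_
  by_cases hx : x ∈ σ.1
  · obtain ⟨c, hc⟩ := exists_faceMap_eq σ (vertex K x) (support_vertex_subset hx)
    let F : C(stdSimplex ℝ σ.1 × unitInterval, Realization K) :=
      ⟨fun q => faceMap σ (simplexLine q.1 c q.2), (continuous_faceMap σ).comp (by
        refine Continuous.subtype_mk ?_ _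
        have h1 : Continuous fun q : stdSimplex ℝ σ.1 × unitInterval => (q.1 : σ.1 → ℝ) :=
          continuous_subtype_val.comp continuous_fst
        fun_prop)⟩
    refine F.curry.continuous.continuousOn.congr fun a ha => ?_
    ext1 t
    change starContract x (faceMap σ a) t = faceMap σ (simplexLine a c t)
    rw [starContract_apply ha, ← linePoint_faceMap σ a c
      ⟨σ.1, σ.2, support_faceMap_subset σ a, support_faceMap_subset σ c⟩]
    apply Realization.ext
    change _ + _ • (vertex K x).weight = _ + _ • (faceMap σ c).weight
    rw [hc]
  · convert! continuousOn_empty _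
    ext a
    change 0 < (faceMap σ a).weight x ↔ _
    simp [faceMap_apply_of_notMem σ a hx]

instance : ContractibleSpace unitInterval :=
  (convex_Icc (0 : ℝ) 1).contractibleSpace ⟨0, by simp⟩

/-- A path inside an open star is homotopic to the path through the centre of the star. -/
theorem trans_linePath_of_mem_openStar {x : V} {z w : Realization K} (p : Path z w)
    (hp : ∀ t, p t ∈ openStar K x) (hz : z ∈ openStar K x) (hw : w ∈ openStar K x) :
    (p.trans (linePath (cofacial_of_mem_openStar hw))).Homotopic
      (linePath (cofacial_of_mem_openStar hz)) := by
  have hc : Continuous fun t => starContract x (p t) :=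
    (continuousOn_starContract x).comp_continuous p.continuous hp
  let Φ : C(unitInterval × unitInterval, Realization K) :=
    ContinuousMap.uncurry ⟨_, hc⟩
  have hΦ : ∀ t s, Φ (t, s) = linePath (cofacial_of_mem_openStar (hp t)) s := fun t s =>
    starContract_apply (hp t) s
  let i : Path (0 : unitInterval) 1 := ⟨ContinuousMap.id _, rfl, rfl⟩
  -- `Φ (t, s)` is the point at time `s` of the segment from `p t` to `x`. The two routes along the
  -- boundary of the square from `(0, 0)` to `(1, 1)` are homotopic. One yields `p` followed by the
  -- segment from `w`, the other the segment from `z` followed by a constant path.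
  have key := Path.Homotopic.map (SimplyConnectedSpace.paths_homotopic
    ((i.prod (Path.refl 0)).trans ((Path.refl 1).prod i))
    (((Path.refl 0).prod i).trans (i.prod (Path.refl 1)))) Φ
  have h0 : z = Φ (0, 0) := by rw [hΦ, Path.source, Path.source]
  have h1 : vertex K x = Φ (1, 1) := by rw [hΦ, Path.target]
  have key' := key.pathCast h0 h1
  have e1 : (p.trans (linePath (cofacial_of_mem_openStar hw))) =
      (((i.prod (Path.refl 0)).trans ((Path.refl 1).prod i)).map Φ.continuous).cast h0 h1 := by
    ext1; funext t
    rw [Path.map_trans]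
    simp only [Path.cast_coe, Path.trans_apply]
    split_ifs
    · exact (Path.source _).symm.trans (hΦ _ _).symm
    · exact (linePath_apply_congr p.target.symm _ _ _).trans (hΦ _ _).symm
  have e2 : ((linePath (cofacial_of_mem_openStar hz)).trans (Path.refl _)) =
      ((((Path.refl 0).prod i).trans (i.prod (Path.refl 1))).map Φ.continuous).cast h0 h1 := by
    ext1; funext t
    rw [Path.map_trans]
    simp only [Path.cast_coe, Path.trans_apply]
    split_ifs
    · exact (linePath_apply_congr p.source.symm _ _ _).trans (hΦ _ _).symm
    · exact (Path.target _).symm.trans (hΦ _ _).symm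
  rw [← e1, ← e2] at key'
  exact key'.trans ⟨Path.Homotopy.transRefl _⟩

end Realization

namespace Realization

variable {V : Type u} {W : Type v} {K : AbstractSimplicialComplex V}
  {L : AbstractSimplicialComplex W}

/-! ### Edge paths -/

theorem edgePath_apply_congr {x y x' y' : V} (hx : x = x') (hy : y = y') (h : SpanEdge K x y)
    (h' : SpanEdge K x' y') (t : unitInterval) : edgePath h t = edgePath h' t := by
  subst hx hy
  rfl

theorem seqPath_apply_congr {x x' : ℕ → V} : ∀ {n : ℕ} (h : ∀ i < n, SpanEdge K (x i) (x (i + 1)))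
    (h' : ∀ i < n, SpanEdge K (x' i) (x' (i + 1))), (∀ i ≤ n, x i = x' i) →
    ∀ t : unitInterval, seqPath x n h t = seqPath x' n h' t
  | 0, _, _, e, _ => congrArg (vertex K) (e 0 le_rfl)
  | n + 1, h, h', e, t => by
    simp only [seqPath, Path.trans_apply]
    split_ifs
    · exact seqPath_apply_congr _ _ (fun i hi => e i (Nat.le_succ_of_le hi)) _
    · exact edgePath_apply_congr (e n (Nat.le_succ n)) (e (n + 1) le_rfl) _ _ _

theorem map_edgePath_apply (φ : SimplicialMap K L) {x y : V} (h : SpanEdge K x y)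
    (h' : SpanEdge L (φ.onVertices x) (φ.onVertices y)) (t : unitInterval) :
    map φ (edgePath h t) = edgePath h' t := by
  apply Realization.ext
  change Finsupp.mapDomain _ (_ + _) = _ + _
  rw [Finsupp.mapDomain_add, Finsupp.mapDomain_single, Finsupp.mapDomain_single]

theorem map_seqPath_apply (φ : SimplicialMap K L) {x : ℕ → V} : ∀ {n : ℕ}
    (h : ∀ i < n, SpanEdge K (x i) (x (i + 1)))
    (h' : ∀ i < n, SpanEdge L (φ.onVertices (x i)) (φ.onVertices (x (i + 1))))
    (t : unitInterval), map φ (seqPath x n h t) = seqPath (fun i => φ.onVertices (x i)) n h' t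
  | 0, _, _, _ => map_vertex φ rfl
  | n + 1, h, h', t => by
    simp only [seqPath, Path.trans_apply]
    split_ifs
    · exact map_seqPath_apply φ _ _ _
    · exact map_edgePath_apply φ _ _ _

/-- Simplicial approximation of a path cut into pieces that each lie in an open star. The statement
is made for every `v` whose star contains the current endpoint, because the induction applies it to
the vertex `w` whose star contains the next piece. -/
theorem exists_seqPath_homotopic_subpath {b : V} {c : Realization K} (γ : Path (vertex K b) c)
    {t : ℕ → unitInterval} (h0 : t 0 = 0) (hmono : Monotone t)
    (hcov : ∀ n, ∃ w, Set.Icc (t n) (t (n + 1)) ⊆ γ ⁻¹' openStar K w) (n : ℕ) :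
    ∀ (v : V) (hv : γ (t n) ∈ openStar K v),
      ∃ (m : ℕ) (x : ℕ → V) (hx : ∀ i < m, SpanEdge K (x i) (x (i + 1)))
        (e0 : γ (t 0) = vertex K (x 0)) (em : vertex K v = vertex K (x m)), x 0 = b ∧ x m = v ∧
        ((γ.subpath (t 0) (t n)).trans (linePath (cofacial_of_mem_openStar hv))).Homotopic
          ((seqPath x m hx).cast e0 em) := by
  induction n with
  | zero =>
    intro v hv
    have e : γ (t 0) = vertex K b := by rw [h0, γ.source]
    -- A vertex lies in no open star but its own.
    obtain rfl : b = v := eq_of_vertex_mem_openStar (e ▸ hv)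
    refine ⟨0, fun _ => b, by simp, e, rfl, rfl, rfl, ?_⟩
    have h1 : linePath (cofacial_of_mem_openStar hv) = (Path.refl (vertex K b)).cast e rfl := by
      ext1; funext s
      rw [linePath_apply_congr e _ (cofacial_vertex ⟨{b}, K.singleton_mem b, by simp, by simp⟩),
        linePath_self]
      rfl
    rw [Path.subpath_self, h1]
    exact ⟨Path.Homotopy.reflTrans _⟩
  | succ n ih =>
    intro v hv
    obtain ⟨w, hw⟩ := hcov n
    have hle : t n ≤ t (n + 1) := hmono (Nat.le_succ n)
    have hw1 : γ (t n) ∈ openStar K w := hw ⟨le_rfl, hle⟩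
    have hw2 : γ (t (n + 1)) ∈ openStar K w := hw ⟨hle, le_rfl⟩
    obtain ⟨m, x, hx, e0, em, hx0, hxm, hhom⟩ := ih w hw1
    -- Both stars contain `γ (t (n + 1))`, so `w` and `v` belong to the support of that point, which
    -- is a face.
    have hwv : SpanEdge K w v := ⟨_, (γ (t (n + 1))).support_mem,
      mem_support_of_mem_openStar hw2, mem_support_of_mem_openStar hv⟩
    let x' : ℕ → V := fun i => if i ≤ m then x i else v
    have hx'1 : ∀ i ≤ m, x' i = x i := fun i hi => if_pos hi
    have hx'2 : x' (m + 1) = v := if_neg (by simp)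
    have hx'3 : ∀ i < m, SpanEdge K (x' i) (x' (i + 1)) := fun i hi => by
      rw [hx'1 i hi.le, hx'1 (i + 1) hi]
      exact hx i hi
    have hx' : ∀ i < m + 1, SpanEdge K (x' i) (x' (i + 1)) := fun i hi => by
      rcases Nat.lt_succ_iff_lt_or_eq.1 hi with hi | rfl
      · exact hx'3 i hi
      · rw [hx'2, hx'1 i le_rfl, hxm]
        exact hwv
    refine ⟨m + 1, x', hx', by rw [e0, hx'1 0 (Nat.zero_le _)], by rw [hx'2],
      by rw [hx'1 0 (Nat.zero_le _), hx0], hx'2, ?_⟩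
    have e1 : (seqPath x' (m + 1) hx').cast (by rw [e0, hx'1 0 (Nat.zero_le _)]) (by rw [hx'2]) =
        ((seqPath x m hx).cast e0 em).trans (edgePath hwv) := by
      ext1; funext s
      simp only [seqPath, Path.cast_coe, Path.trans_apply]
      split_ifs
      · exact seqPath_apply_congr _ _ hx'1 _
      · exact edgePath_apply_congr ((hx'1 m le_rfl).trans hxm) hx'2 _ _ _
    rw [e1]
    have hstar : ∀ s, γ.subpath (t n) (t (n + 1)) s ∈ openStar K w := fun s => by
      have : γ.subpath (t n) (t (n + 1)) s ∈ Set.range (γ.subpath (t n) (t (n + 1))) := ⟨s, rfl⟩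
      rw [Path.range_subpath_of_le γ _ _ hle] at this
      obtain ⟨r, hr, hrs⟩ := this
      rw [← hrs]
      exact hw hr
    have k1 := trans_linePath_of_mem_openStar _ hstar hw1 hw2
    have k2 : ((γ.subpath (t 0) (t n)).trans (γ.subpath (t n) (t (n + 1)))).Homotopic
      (γ.subpath (t 0) (t (n + 1))) := ⟨Path.Homotopy.subpathTransSubpath γ _ _ _⟩
    have k3 : ((linePath (cofacial_of_mem_openStar hw2)).trans (edgePath hwv)).Homotopic
        (linePath (cofacial_of_mem_openStar hv)) := by
      rw [edgePath_eq_linePath]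
      exact linePath_trans (γ (t (n + 1))).support_mem subset_rfl
        (support_vertex_subset (mem_support_of_mem_openStar hw2))
        (support_vertex_subset (mem_support_of_mem_openStar hv)) _ _ _
    rw [← Path.Homotopic.Quotient.eq] at hhom k1 k2 k3 ⊢
    simp only [Path.Homotopic.Quotient.mk_trans] at hhom k1 k2 k3 ⊢
    rw [← k2, ← k3, ← hhom, ← k1]
    simp only [Path.Homotopic.Quotient.trans_assoc]

end Realization

/-! ### Simplicial loops and the fundamental group -/

namespace SimplicialLoop

variable {V : Type u} {W : Type v} {K : AbstractSimplicialComplex V}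
  {L : AbstractSimplicialComplex W} {b : V} {c : W}

/-- Every class in the fundamental group is the class of a simplicial loop. -/
theorem classPi1_surjective : Function.Surjective (classPi1 (K := K) (b := b)) := by
  intro q
  obtain ⟨γ, rfl⟩ := Path.Homotopic.Quotient.mk_surjective q
  -- Lebesgue's lemma for the cover of the interval by preimages of open stars; `t` is eventually
  -- `1`.
  obtain ⟨t, h0, hmono, ⟨n, hn⟩, hcov⟩ := exists_monotone_Icc_subset_open_cover_unitInterval
    (c := fun x => γ ⁻¹' Realization.openStar K x)
    (fun x => (Realization.isOpen_openStar x).preimage γ.continuous)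
    (fun s _ => Set.mem_iUnion.2 (Realization.exists_mem_openStar (γ s)))
  have en : γ (t n) = Realization.vertex K b := by rw [hn n le_rfl, γ.target]
  -- The approximation is closed up at `v = b`, where the final segment is constant.
  have hb : γ (t n) ∈ Realization.openStar K b := by
    rw [en]
    change 0 < Finsupp.single b (1 : ℝ) b
    simp
  obtain ⟨m, x, hx, e0, em, hx0, hxm, hhom⟩ :=
    Realization.exists_seqPath_homotopic_subpath γ h0 hmono hcov n b hb
  refine ⟨⟨m, x, hx0, hxm, hx⟩, ?_⟩
  have h1 : Realization.linePath (Realization.cofacial_of_mem_openStar hb) =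
      (Path.refl (Realization.vertex K b)).cast en rfl := by
    ext1; funext s
    rw [Realization.linePath_apply_congr en _
      (Realization.cofacial_vertex ⟨{b}, K.singleton_mem b, by simp, by simp⟩),
      Realization.linePath_self]
    rfl
  have e0' : Realization.vertex K b = γ (t 0) := by rw [h0, γ.source]
  have h2 := hhom.pathCast e0' rfl
  rw [h1] at h2
  have h3 : ((γ.subpath (t 0) (t n)).trans
      ((Path.refl (Realization.vertex K b)).cast en rfl)).cast e0' rfl =
      γ.trans (Path.refl _) := by
    ext1; funext s
    simp only [Path.cast_coe, Path.trans_apply]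
    split_ifs
    · simp [Path.subpath, h0, hn n le_rfl]
    · rfl
  rw [h3] at h2
  exact Path.Homotopic.Quotient.eq.2 (h2.symm.trans ⟨Path.Homotopy.transRefl _⟩)

/-- The image of a simplicial loop under a simplicial map. -/
def map (φ : SimplicialMap K L) (h : φ.onVertices b = c) (ℓ : SimplicialLoop K b) :
    SimplicialLoop L c where
  size := ℓ.size
  pt i := φ.onVertices (ℓ.pt i)
  pt_zero := by rw [ℓ.pt_zero, h]
  pt_size := by rw [ℓ.pt_size, h]
  edge i hi := by
    obtain ⟨σ, hσ, h1, h2⟩ := ℓ.edge i hi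
    obtain ⟨τ, hτ, h3⟩ := φ.map_face σ hσ
    exact ⟨τ, hτ, h3 _ h1, h3 _ h2⟩

theorem map_classPi1 (φ : SimplicialMap K L) (h : φ.onVertices b = c) (ℓ : SimplicialLoop K b) :
    Pi1.map φ h ℓ.classPi1 = (ℓ.map φ h).classPi1 := by
  change FundamentalGroup.mapOfEq _ _ _ = _
  rw [FundamentalGroup.mapOfEq_apply]
  change (Path.Homotopic.Quotient.map (Path.Homotopic.Quotient.mk _) _).cast _ _ =
    Path.Homotopic.Quotient.mk _
  rw [← Path.Homotopic.Quotient.mk_map, ← Path.Homotopic.Quotient.mk_cast]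
  exact congrArg _ (Path.ext (funext fun t =>
    Realization.map_seqPath_apply φ ℓ.edge (ℓ.map φ h).edge t))

/-- Two simplicial loops of the same length are contiguous if corresponding edges span a common
simplex. -/
structure Contiguous (ℓ ℓ' : SimplicialLoop K b) : Prop where
  size_eq : ℓ.size = ℓ'.size
  face : ∀ i < ℓ.size, ∃ σ ∈ K.faces, ℓ.pt i ∈ σ ∧ ℓ.pt (i + 1) ∈ σ ∧ ℓ'.pt i ∈ σ ∧
    ℓ'.pt (i + 1) ∈ σ

end SimplicialLoop

/-! ### Contiguous loops are homotopic -/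

theorem SpanEdge.refl {V : Type u} (K : AbstractSimplicialComplex V) (x : V) : SpanEdge K x x :=
  ⟨{x}, K.singleton_mem x, by simp, by simp⟩

theorem SpanEdge.symm {V : Type u} {K : AbstractSimplicialComplex V} {x y : V}
    (h : SpanEdge K x y) : SpanEdge K y x := by
  obtain ⟨σ, hσ, h1, h2⟩ := h
  exact ⟨σ, hσ, h2, h1⟩

/-- The sequences form the rails of a ladder each of whose cells lies in one simplex. A cell is
crossed by cutting it along the diagonal from `x n` to `y (n + 1)` into two triangles. -/
theorem Realization.seqPath_trans_edgePath_homotopic {V : Type u}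
    {K : AbstractSimplicialComplex V} {x y : ℕ → V} {n : ℕ}
    (hx : ∀ i < n, SpanEdge K (x i) (x (i + 1))) (hy : ∀ i < n, SpanEdge K (y i) (y (i + 1)))
    (h : ∀ i < n, ∃ σ ∈ K.faces, x i ∈ σ ∧ x (i + 1) ∈ σ ∧ y i ∈ σ ∧ y (i + 1) ∈ σ)
    (h0 : SpanEdge K (x 0) (y 0)) (hn : SpanEdge K (x n) (y n)) :
    ((seqPath x n hx).trans (edgePath hn)).Homotopic ((edgePath h0).trans (seqPath y n hy)) := by
  induction n with
  | zero =>
    exact Path.Homotopic.trans (p₁ := edgePath h0) ⟨Path.Homotopy.reflTrans _⟩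
      ⟨(Path.Homotopy.transRefl _).symm⟩
  | succ n ih =>
    obtain ⟨σ, hσ, h1, h2, h3, h4⟩ := h n (Nat.lt_succ_self n)
    have hn' : SpanEdge K (x n) (y n) := ⟨σ, hσ, h1, h3⟩
    have hd : SpanEdge K (x n) (y (n + 1)) := ⟨σ, hσ, h1, h4⟩
    have ih' := ih (fun i hi => hx i (Nat.lt_succ_of_lt hi))
      (fun i hi => hy i (Nat.lt_succ_of_lt hi)) (fun i hi => h i (Nat.lt_succ_of_lt hi)) hn'
    have k1 := edgePath_trans hσ h1 h2 h4 (hx n (Nat.lt_succ_self n)) hn hd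
    have k2 := edgePath_trans hσ h1 h3 h4 hn' (hy n (Nat.lt_succ_self n)) hd
    rw [← Path.Homotopic.Quotient.eq] at ih' k1 k2 ⊢
    simp only [seqPath, Path.Homotopic.Quotient.mk_trans] at ih' k1 k2 ⊢
    rw [Path.Homotopic.Quotient.trans_assoc, k1, ← k2, ← Path.Homotopic.Quotient.trans_assoc, ih',
      Path.Homotopic.Quotient.trans_assoc]

namespace SimplicialLoop

variable {V : Type u} {K : AbstractSimplicialComplex V} {b : V}

/-- For based loops both end rungs of the ladder are the degenerate edge at `b`, whose path is
constant. -/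
theorem Contiguous.classPi1_eq {ℓ ℓ' : SimplicialLoop K b} (h : Contiguous ℓ ℓ') :
    ℓ.classPi1 = ℓ'.classPi1 := by
  obtain ⟨n, x, hx0, hxn, hx⟩ := ℓ
  obtain ⟨n', y, hy0, hyn, hy⟩ := ℓ'
  obtain ⟨hsize, hface⟩ := h
  obtain rfl : n = n' := hsize
  have h0 : SpanEdge K (x 0) (y 0) := by rw [hx0, hy0]; exact SpanEdge.refl K b
  have hn : SpanEdge K (x n) (y n) := by rw [hxn, hyn]; exact SpanEdge.refl K b
  have key := (Realization.seqPath_trans_edgePath_homotopic hx hy hface h0 hn).pathCast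
    (congrArg (Realization.vertex K) hx0.symm) (congrArg (Realization.vertex K) hyn.symm)
  have e1 : ((Realization.seqPath x n hx).trans (Realization.edgePath hn)).cast
      (congrArg (Realization.vertex K) hx0.symm) (congrArg (Realization.vertex K) hyn.symm) =
      ((Realization.seqPath x n hx).cast (congrArg (Realization.vertex K) hx0.symm)
        (congrArg (Realization.vertex K) hxn.symm)).trans (Path.refl _) := by
    ext1; funext t
    simp only [Path.cast_coe, Path.trans_apply]
    split_ifs
    · rfl
    · rw [Realization.edgePath_apply_congr hxn hyn hn (SpanEdge.refl K b),
        Realization.edgePath_self]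
  have e2 : ((Realization.edgePath h0).trans (Realization.seqPath y n hy)).cast
      (congrArg (Realization.vertex K) hx0.symm) (congrArg (Realization.vertex K) hyn.symm) =
      (Path.refl _).trans ((Realization.seqPath y n hy).cast
        (congrArg (Realization.vertex K) hy0.symm)
        (congrArg (Realization.vertex K) hyn.symm)) := by
    ext1; funext t
    simp only [Path.cast_coe, Path.trans_apply]
    split_ifs
    · rw [Realization.edgePath_apply_congr hx0 hy0 h0 (SpanEdge.refl K b),
        Realization.edgePath_self]
    · rfl
  rw [e1, e2] at key
  exact Path.Homotopic.Quotient.eq.2 (Path.Homotopic.trans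
    (Path.Homotopic.trans ⟨(Path.Homotopy.transRefl _).symm⟩ key) ⟨Path.Homotopy.reflTrans _⟩)

end SimplicialLoop

/-! ### Edges modulo boundaries -/

section Homology

variable {V : Type u} {W : Type v} {K : AbstractSimplicialComplex V}
  {L : AbstractSimplicialComplex W} {G : Type w} [AddCommGroup G]

/-- The simplicial `1`-chains modulo boundaries. -/
def ChainsModBoundaries (K : AbstractSimplicialComplex V) (G : Type w) [AddCommGroup G] :
    Type (max u w) :=
  SimplicialChain K G 1 ⧸ (simplicialBoundary K G 1).range

instance : AddCommGroup (ChainsModBoundaries K G) :=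
  inferInstanceAs (AddCommGroup (SimplicialChain K G 1 ⧸ (simplicialBoundary K G 1).range))

/-- The projection from `1`-chains to `1`-chains modulo boundaries. -/
def ChainsModBoundaries.proj (K : AbstractSimplicialComplex V) (G : Type w) [AddCommGroup G] :
    SimplicialChain K G 1 →+ ChainsModBoundaries K G :=
  QuotientAddGroup.mk' (simplicialBoundary K G 1).range

theorem ChainsModBoundaries.proj_eq_zero_iff {c : SimplicialChain K G 1} :
    proj K G c = 0 ↔ c ∈ (simplicialBoundary K G 1).range :=
  QuotientAddGroup.eq_zero_iff c

/-- The inclusion of first homology into the `1`-chains modulo boundaries. -/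
def H1.toChains (K : AbstractSimplicialComplex V) (G : Type w) [AddCommGroup G] :
    H1 K G →+ ChainsModBoundaries K G :=
  QuotientAddGroup.lift _ ((ChainsModBoundaries.proj K G).comp (cycles1 K G).subtype)
    fun _ h => ChainsModBoundaries.proj_eq_zero_iff.2 h

/-- A single edge need not be a cycle, but it has a class modulo boundaries. Injectivity allows
identities in H₁ to be checked edge by edge in this larger group. -/
theorem H1.toChains_injective : Function.Injective (H1.toChains K G) := by
  rw [injective_iff_map_eq_zero]
  intro γ h
  obtain ⟨c, rfl⟩ := QuotientAddGroup.mk_surjective γ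
  exact (QuotientAddGroup.eq_zero_iff c).2 (ChainsModBoundaries.proj_eq_zero_iff.1 h)

/-- The class of an edge in the `1`-chains modulo boundaries. -/
def edgeClass (G : Type w) [AddCommGroup G] {x y : V} (h : SpanEdge K x y) :
    G →+ ChainsModBoundaries K G :=
  (ChainsModBoundaries.proj K G).comp (Finsupp.singleAddHom (OrderedSimplex.edge h))

/-- The boundary of the ordered triangle `(x, y, z)` is `(y, z) - (x, z) + (x, y)`. Since
repetitions are allowed, degenerate triangles are covered too. -/
theorem edgeClass_add {x y z : V} {σ : Finset V} (hσ : σ ∈ K.faces) (hx : x ∈ σ) (hy : y ∈ σ)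
    (hz : z ∈ σ) (h₁ : SpanEdge K x y) (h₂ : SpanEdge K y z) (h₃ : SpanEdge K x z) :
    edgeClass G h₁ + edgeClass G h₂ = edgeClass G h₃ := by
  ext g
  let τ : OrderedSimplex K 2 := ⟨![x, y, z], σ, hσ, fun i => by fin_cases i <;> assumption⟩
  have f0 : τ.face 0 = OrderedSimplex.edge h₂ := Subtype.ext (by funext j; fin_cases j <;> rfl)
  have f1 : τ.face 1 = OrderedSimplex.edge h₃ := Subtype.ext (by funext j; fin_cases j <;> rfl)
  have f2 : τ.face 2 = OrderedSimplex.edge h₁ := Subtype.ext (by funext j; fin_cases j <;> rfl)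
  change ChainsModBoundaries.proj K G (Finsupp.single (OrderedSimplex.edge h₁) g) +
    ChainsModBoundaries.proj K G (Finsupp.single (OrderedSimplex.edge h₂) g) =
    ChainsModBoundaries.proj K G (Finsupp.single (OrderedSimplex.edge h₃) g)
  rw [← sub_eq_zero, ← map_add, ← map_sub]
  refine ChainsModBoundaries.proj_eq_zero_iff.2 ⟨Finsupp.single τ g, ?_⟩
  have : simplicialBoundary K G 1 (Finsupp.single τ g) =
      ∑ i : Fin 3, ((-1 : ℤ) ^ (i : ℕ)) • Finsupp.single (τ.face i) g := by
    simp [simplicialBoundary]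
  rw [this, Fin.sum_univ_three, f0, f1, f2]
  simp only [Fin.val_zero, Fin.val_one, Fin.val_two, pow_zero, pow_one, one_smul, neg_smul,
    even_two, Even.neg_pow, one_pow]
  abel

/-- A degenerate edge is a nonzero basis element of the ordered chains, but the triangle `(x, x, x)`
makes it a boundary. -/
theorem edgeClass_self {x : V} (h : SpanEdge K x x) : edgeClass G h = 0 := by
  have := edgeClass_add (G := G) (K.singleton_mem x) (Finset.mem_singleton_self x)
    (Finset.mem_singleton_self x) (Finset.mem_singleton_self x) h h h
  simpa using this

theorem edgeClass_symm {x y : V} (h : SpanEdge K x y) :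
    edgeClass G h.symm = -edgeClass G h := by
  obtain ⟨σ, hσ, hx, hy⟩ := id h
  have := edgeClass_add (G := G) hσ hx hy hx h h.symm (SpanEdge.refl K x)
  rw [edgeClass_self] at this
  exact (neg_eq_of_add_eq_zero_right this).symm

theorem edgeClass_congr {x y x' y' : V} (hx : x = x') (hy : y = y') (h : SpanEdge K x y)
    (h' : SpanEdge K x' y') : edgeClass G h = edgeClass G h' := by
  subst hx hy
  rfl

namespace SimplicialLoop

variable {b : V} {c : W}

theorem toChains_classH1 (ℓ : SimplicialLoop K b) (g : G) :
    H1.toChains K G (ℓ.classH1 g) = ∑ i : Fin ℓ.size, edgeClass G (ℓ.edge i i.2) g :=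
  map_sum (ChainsModBoundaries.proj K G)
    (fun i : Fin ℓ.size => Finsupp.single (OrderedSimplex.edge (ℓ.edge i i.2)) g) Finset.univ

theorem map_classH1 (φ : SimplicialMap K L) (h : φ.onVertices b = c) (ℓ : SimplicialLoop K b)
    (g : G) : H1.map φ G (ℓ.classH1 g) = (ℓ.map φ h).classH1 g := by
  change QuotientAddGroup.mk _ = QuotientAddGroup.mk _
  congr 1
  apply Subtype.ext
  change simplicialChainMap φ G 1 (∑ i : Fin ℓ.size, _) = ∑ i : Fin ℓ.size, _
  rw [map_sum]
  refine Finset.sum_congr rfl fun i _ => ?_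
  refine Finsupp.mapDomain_single.trans (congrArg (Finsupp.single · g) (Subtype.ext ?_))
  funext j
  fin_cases j <;> rfl

end SimplicialLoop

/-- The additive version of the ladder argument, with the same diagonals. -/
theorem sum_edgeClass_add {x y : ℕ → V} {n : ℕ}
    (hx : ∀ i < n, SpanEdge K (x i) (x (i + 1))) (hy : ∀ i < n, SpanEdge K (y i) (y (i + 1)))
    (h : ∀ i < n, ∃ σ ∈ K.faces, x i ∈ σ ∧ x (i + 1) ∈ σ ∧ y i ∈ σ ∧ y (i + 1) ∈ σ)
    (h0 : SpanEdge K (x 0) (y 0)) (hn : SpanEdge K (x n) (y n)) :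
    (∑ i : Fin n, edgeClass G (hx i i.2)) + edgeClass G hn =
      edgeClass G h0 + ∑ i : Fin n, edgeClass G (hy i i.2) := by
  induction n with
  | zero => simp
  | succ n ih =>
    obtain ⟨σ, hσ, h1, h2, h3, h4⟩ := h n (Nat.lt_succ_self n)
    have hn' : SpanEdge K (x n) (y n) := ⟨σ, hσ, h1, h3⟩
    have hd : SpanEdge K (x n) (y (n + 1)) := ⟨σ, hσ, h1, h4⟩
    have ih' := ih (fun i hi => hx i (Nat.lt_succ_of_lt hi))
      (fun i hi => hy i (Nat.lt_succ_of_lt hi)) (fun i hi => h i (Nat.lt_succ_of_lt hi)) hn'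
    have k1 := edgeClass_add (G := G) hσ h1 h2 h4 (hx n (Nat.lt_succ_self n)) hn hd
    have k2 := edgeClass_add (G := G) hσ h1 h3 h4 hn' (hy n (Nat.lt_succ_self n)) hd
    rw [Fin.sum_univ_castSucc, Fin.sum_univ_castSucc, add_assoc]
    simp only [Fin.val_castSucc, Fin.val_last]
    rw [k1, ← k2, ← add_assoc, ih', add_assoc]

theorem SimplicialLoop.Contiguous.classH1_eq {b : V} {ℓ ℓ' : SimplicialLoop K b}
    (h : Contiguous ℓ ℓ') (g : G) : ℓ.classH1 g = ℓ'.classH1 g := by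
  apply H1.toChains_injective
  rw [toChains_classH1, toChains_classH1]
  obtain ⟨n, x, hx0, hxn, hx⟩ := ℓ
  obtain ⟨n', y, hy0, hyn, hy⟩ := ℓ'
  obtain ⟨hsize, hface⟩ := h
  obtain rfl : n = n' := hsize
  have h0 : SpanEdge K (x 0) (y 0) := by rw [hx0, hy0]; exact SpanEdge.refl K b
  have hn : SpanEdge K (x n) (y n) := by rw [hxn, hyn]; exact SpanEdge.refl K b
  have key := sum_edgeClass_add (G := G) hx hy hface h0 hn
  rw [edgeClass_congr hxn hyn hn (SpanEdge.refl K b),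
    edgeClass_congr hx0 hy0 h0 (SpanEdge.refl K b), edgeClass_self, add_zero, zero_add] at key
  simpa using DFunLike.congr_fun key g

/-! ### First homology of a connected complex is generated by based loops -/

/-- `WalkClass K x y f`: the map `f` is the sum of the edge classes of a sequence of vertices from
`x` to `y` in which consecutive vertices span an edge. -/
inductive WalkClass (K : AbstractSimplicialComplex V) (x : V) :
    (y : V) → (G →+ ChainsModBoundaries K G) → Prop
  | nil : WalkClass K x x 0
  | snoc {y z : V} {f : G →+ ChainsModBoundaries K G} (hf : WalkClass K x y f)
      (h : SpanEdge K y z) : WalkClass K x z (f + edgeClass G h)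

namespace WalkClass

variable {x y z b : V} {f f' : G →+ ChainsModBoundaries K G}

theorem trans (hf : WalkClass K x y f) (hf' : WalkClass K y z f') :
    WalkClass K x z (f + f') := by
  induction hf' with
  | nil => simpa using hf
  | snoc _ h ih =>
    rw [← add_assoc]
    exact ih.snoc h

theorem symm (hf : WalkClass K x y f) : WalkClass K y x (-f) := by
  induction hf with
  | nil => simpa using (nil : WalkClass K x x (0 : G →+ ChainsModBoundaries K G))
  | snoc _ h ih =>
    rw [neg_add_rev, ← edgeClass_symm, ← zero_add (edgeClass G h.symm)]
    exact (nil.snoc h.symm).trans ih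

theorem exists_sequence (hf : WalkClass K x y f) :
    ∃ (n : ℕ) (pt : ℕ → V) (h : ∀ i < n, SpanEdge K (pt i) (pt (i + 1))), pt 0 = x ∧ pt n = y ∧
      ∑ i : Fin n, edgeClass G (h i i.2) = f := by
  induction hf with
  | nil => exact ⟨0, fun _ => x, by simp, rfl, rfl, by simp⟩
  | @snoc y z f _ h ih =>
    obtain ⟨n, pt, hpt, h0, hn, hsum⟩ := ih
    let pt' : ℕ → V := fun i => if i ≤ n then pt i else z
    have e1 : ∀ i ≤ n, pt' i = pt i := fun i hi => if_pos hi
    have e2 : pt' (n + 1) = z := if_neg (by simp)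
    have hpt' : ∀ i < n + 1, SpanEdge K (pt' i) (pt' (i + 1)) := fun i hi => by
      rcases Nat.lt_succ_iff_lt_or_eq.1 hi with hi | rfl
      · rw [e1 i hi.le, e1 (i + 1) hi]
        exact hpt i hi
      · rw [e2, e1 i le_rfl, hn]
        exact h
    refine ⟨n + 1, pt', hpt', by rw [e1 0 (Nat.zero_le _), h0], e2, ?_⟩
    rw [Fin.sum_univ_castSucc, ← hsum]
    congr 1
    · exact Finset.sum_congr rfl fun i _ => edgeClass_congr (e1 i i.2.le) (e1 (i + 1) i.2) _ _
    · exact edgeClass_congr ((e1 n le_rfl).trans hn) e2 _ _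

theorem exists_loop (hf : WalkClass K b b f) :
    ∃ ℓ : SimplicialLoop K b, ∀ g, H1.toChains K G (ℓ.classH1 g) = f g := by
  obtain ⟨n, pt, h, h0, hn, hsum⟩ := hf.exists_sequence
  refine ⟨⟨n, pt, h0, hn, h⟩, fun g => ?_⟩
  rw [SimplicialLoop.toChains_classH1, ← hsum]
  simp

end WalkClass

theorem OrderedSimplex.spanEdge (e : OrderedSimplex K 1) : SpanEdge K (e.1 0) (e.1 1) := by
  obtain ⟨σ, hσ, h⟩ := e.2
  exact ⟨σ, hσ, h 0, h 1⟩

theorem OrderedSimplex.edge_spanEdge (e : OrderedSimplex K 1) :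
    OrderedSimplex.edge e.spanEdge = e :=
  Subtype.ext (by funext j; fin_cases j <;> rfl)

/-- With a walk `P v` chosen from `b` to each vertex `v`, an edge `e` from `u` to `v` becomes the
based loop `P u`, `e`, reversed `P v`. Its class differs from that of `e` by `P u - P v`, and these
corrections cancel over a cycle. -/
theorem H1.exists_sum_classH1 {b : V}
    (hK : ∀ v, ∃ f : G →+ ChainsModBoundaries K G, WalkClass K b v f) (γ : H1 K G) :
    ∃ (m : ℕ) (g : Fin m → G) (ℓ : Fin m → SimplicialLoop K b),
      ∑ j, (ℓ j).classH1 (g j) = γ := by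
  choose P hP using hK
  have hloop : ∀ e : OrderedSimplex K 1, ∃ ℓ : SimplicialLoop K b, ∀ g : G,
      H1.toChains K G (ℓ.classH1 g) =
        (P (e.1 0) + edgeClass G e.spanEdge + -P (e.1 1)) g := fun e =>
    (((hP _).snoc e.spanEdge).trans (hP _).symm).exists_loop
  choose ℓ hℓ using hloop
  obtain ⟨c, rfl⟩ := QuotientAddGroup.mk_surjective γ
  -- `T` extends `P` to `0`-chains, so the loop of `e` has class `e - T (∂e)`; on a cycle the second
  -- term vanishes.
  let T : SimplicialChain K G 0 →+ ChainsModBoundaries K G :=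
    Finsupp.liftAddHom fun v => P (v.1 0)
  have hT : ∀ (e : OrderedSimplex K 1) (g : G), H1.toChains K G ((ℓ e).classH1 g) =
      (ChainsModBoundaries.proj K G - T.comp (simplicialBoundary K G 0))
        (Finsupp.single e g) := by
    intro e g
    have hb : simplicialBoundary K G 0 (Finsupp.single e g) =
        Finsupp.single (e.face 0) g - Finsupp.single (e.face 1) g := by
      simp [simplicialBoundary, Fin.sum_univ_succ, sub_eq_add_neg]
    rw [hℓ, AddMonoidHom.sub_apply, AddMonoidHom.comp_apply, hb, map_sub]
    have t0 : T (Finsupp.single (e.face 0) g) = P (e.1 1) g := by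
      rw [Finsupp.liftAddHom_apply_single]
      rfl
    have t1 : T (Finsupp.single (e.face 1) g) = P (e.1 0) g := by
      rw [Finsupp.liftAddHom_apply_single]
      rfl
    have t2 : edgeClass G e.spanEdge g = ChainsModBoundaries.proj K G (Finsupp.single e g) := by
      change ChainsModBoundaries.proj K G (Finsupp.single (OrderedSimplex.edge e.spanEdge) g) = _
      rw [e.edge_spanEdge]
    rw [t0, t1, ← t2]
    simp only [AddMonoidHom.add_apply, AddMonoidHom.neg_apply]
    abel
  let ε := c.1.support.equivFin
  refine ⟨c.1.support.card, fun j => c.1 (ε.symm j), fun j => ℓ (ε.symm j), ?_⟩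
  apply H1.toChains_injective
  rw [Equiv.sum_comp ε.symm fun e : c.1.support => (ℓ e).classH1 (c.1 e),
    Finset.sum_coe_sort c.1.support fun e => (ℓ e).classH1 (c.1 e), map_sum,
    Finset.sum_congr rfl fun e _ => hT e (c.1 e), ← map_sum]
  have hc : ∑ e ∈ c.1.support, Finsupp.single e (c.1 e) = c.1 := Finsupp.sum_single c.1
  rw [hc, AddMonoidHom.sub_apply, AddMonoidHom.comp_apply, AddMonoidHom.mem_ker.1 c.2, map_zero,
    sub_zero]
  rfl

end Homology

/-- The Rips complexes of a geodesic space are connected. -/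
theorem exists_walkClass_rips {X : Type u} [MetricSpace X] (hX : IsGeodesicSpace X)
    (G : Type w) [AddCommGroup G] (p : Scale) (b v : X) :
    ∃ f : G →+ ChainsModBoundaries (rips X p) G, WalkClass (rips X p) b v f := by
  have : PathConnectedSpace X := ⟨⟨b⟩, fun x y => ⟨(hX x y).choose⟩⟩
  let R : Set X := {v | ∃ f : G →+ ChainsModBoundaries (rips X p) G, WalkClass (rips X p) b v f}
  have hstep : ∀ x y, x ∈ R → dist x y < p → y ∈ R := fun x y ⟨f, hf⟩ hxy =>
    ⟨_, hf.snoc (spanEdge_rips_iff.2 hxy)⟩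
  -- The `p`-ball about a point of `R` lies in `R`, and likewise for the complement; a path
  -- connected space then forces `R` to be everything.
  have hclopen : IsClopen R := by
    refine ⟨⟨Metric.isOpen_iff.2 fun x hx => ⟨p, p.2, fun y hy hyR => hx ?_⟩⟩,
      Metric.isOpen_iff.2 fun x hx => ⟨p, p.2, fun y hy => hstep x y hx ?_⟩⟩
    · exact hstep y x hyR (Metric.mem_ball.1 hy)
    · exact Metric.mem_ball'.1 hy
  have := hclopen.eq_univ ⟨b, 0, .nil⟩
  exact (this ▸ Set.mem_univ v : v ∈ R)

/-! ### The simplicial map to the sample -/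

section Sample

variable {X : Type u} [MetricSpace X] {S : Set X} {s : ℝ≥0}

/-- A finite nonempty set attains its largest distance, so the strict bound survives. Positivity of
`r` handles the empty set, whose diameter is `0`. -/
theorem diam_lt_of_forall_dist_lt {Y : Type u} [MetricSpace Y] {σ : Finset Y} {r : ℝ}
    (hr : 0 < r) (h : ∀ x ∈ σ, ∀ y ∈ σ, dist x y < r) : Metric.diam (σ : Set Y) < r := by
  rcases σ.eq_empty_or_nonempty with rfl | hne
  · simpa using hr
  obtain ⟨⟨x, y⟩, hxy, hmax⟩ := (σ ×ˢ σ).exists_max_image (fun q => dist q.1 q.2)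
    (hne.product hne)
  rw [Finset.mem_product] at hxy
  refine lt_of_le_of_lt (Metric.diam_le_of_forall_dist_le dist_nonneg fun a ha c hc => ?_)
    (h x hxy.1 y hxy.2)
  exact hmax (a, c) (Finset.mem_product.2 ⟨ha, hc⟩)

theorem mem_rips_of_forall_dist_lt {Y : Type u} [MetricSpace Y] {σ : Finset Y} {r : Scale}
    (hne : σ.Nonempty) (h : ∀ x ∈ σ, ∀ y ∈ σ, dist x y < r) : σ ∈ (rips Y r).faces :=
  ⟨hne, diam_lt_of_forall_dist_lt r.2 h⟩

/-- Four points with pairwise distances less than `r` span a common simplex of the Rips complex. -/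
theorem exists_rips_face_of_four {Y : Type u} [MetricSpace Y] {r : Scale} {x y z w : Y}
    (hxy : dist x y < r) (hxz : dist x z < r) (hxw : dist x w < r) (hyz : dist y z < r)
    (hyw : dist y w < r) (hzw : dist z w < r) :
    ∃ σ ∈ (rips Y r).faces, x ∈ σ ∧ y ∈ σ ∧ z ∈ σ ∧ w ∈ σ := by
  classical
  refine ⟨{x, y, z, w}, mem_rips_of_forall_dist_lt ⟨x, by simp⟩ ?_, by simp, by simp, by simp,
    by simp⟩
  have hr : (0 : ℝ) < r := r.2
  simp only [Finset.mem_insert, Finset.mem_singleton]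
  rintro a (rfl | rfl | rfl | rfl) c (rfl | rfl | rfl | rfl) <;>
    first
    | assumption
    | (rw [dist_self]; exact hr)
    | (rw [dist_comm]; assumption)

open Classical in
/-- A nearest-sample map, equal to the identity on the sample. -/
def samplePoint (hS : IsDenseSample S s) (x : X) : S :=
  if h : x ∈ S then ⟨x, h⟩ else ⟨(hS x).choose, (hS x).choose_spec.1⟩

/-- Fixing `S` pointwise preserves the base point and makes `ν ∘ μ` the bonding map already on
vertices. -/
theorem samplePoint_coe (hS : IsDenseSample S s) (y : S) : samplePoint hS (y : X) = y :=
  dif_pos y.2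

theorem dist_samplePoint_lt (hs : 0 < s) (hS : IsDenseSample S s) (x : X) :
    dist x (samplePoint hS x) < s := by
  by_cases h : x ∈ S
  · rw [samplePoint, dif_pos h, dist_self]
    exact hs
  · rw [samplePoint, dif_neg h]
    exact (hS x).choose_spec.2

theorem Scale.coe_add_two_mul (p : Scale) (s : ℝ≥0) :
    ((p.add (2 * s) : Scale) : ℝ) = p + s + s := by
  change (p : ℝ) + ((2 * s : ℝ≥0) : ℝ) = _
  push_cast
  ring

/-- The source of the shift `2 * s`: the route `y`, `x`, `x'`, `y'` is shorter than `s + p + s`. -/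
theorem dist_lt_of_near {x x' y y' : X} {p : Scale} (h : dist x y < s) (h' : dist x' y' < s)
    (hx : dist x x' < p) : dist y y' < p.add (2 * s) := by
  have := dist_triangle4 y x x' y'
  rw [dist_comm y x] at this
  rw [Scale.coe_add_two_mul]
  linarith

theorem sample_dist_lt_of_near {x x' : X} {y y' : S} {p : Scale} (h : dist x y < s)
    (h' : dist x' y' < s) (hx : dist x x' < p) : dist y y' < p.add (2 * s) :=
  dist_lt_of_near (y := (y : X)) (y' := (y' : X)) h h' hx

/-- The simplicial map `Rips(X, p) → Rips(S, p + 2s)` given by nearby sample points. -/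
def sampleMap (hs : 0 < s) (hS : IsDenseSample S s) (p : Scale) :
    SimplicialMap (rips X p) (rips S (p.add (2 * s))) where
  onVertices := samplePoint hS
  map_face σ hσ := by
    classical
    refine ⟨σ.image (samplePoint hS), mem_rips_of_forall_dist_lt (hσ.1.image _) ?_,
      fun x hx => Finset.mem_image_of_mem _ hx⟩
    intro y hy y' hy'
    obtain ⟨x, hx, rfl⟩ := Finset.mem_image.1 hy
    obtain ⟨x', hx', rfl⟩ := Finset.mem_image.1 hy'
    exact sample_dist_lt_of_near (dist_samplePoint_lt hs hS x) (dist_samplePoint_lt hs hS x')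
      (spanEdge_rips_iff.1 ⟨σ, hσ, hx, hx'⟩)

/-- The choice of sample points given by `samplePoint`. -/
def SampleChoice.ofSamplePoint (hs : 0 < s) (hS : IsDenseSample S s) {b : S} {p : Scale}
    (ℓ : SimplicialLoop (rips X p) (b : X)) : SampleChoice S s b ℓ where
  y i := samplePoint hS (ℓ.pt i)
  y_zero := by rw [ℓ.pt_zero, samplePoint_coe]
  y_size := by rw [ℓ.pt_size, samplePoint_coe]
  near i _ := dist_samplePoint_lt hs hS _

/-- Each of the four sample points is within `s` of `ℓ.pt i` or `ℓ.pt (i + 1)`, so `dist_lt_of_near`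
bounds all six distances. -/
theorem SampleChoice.contiguous (hs : 0 < s) (hS : IsDenseSample S s) {b : S} {p : Scale}
    {ℓ : SimplicialLoop (rips X p) (b : X)} (y : SampleChoice S s b ℓ) :
    (ℓ.map (sampleMap hs hS p) (samplePoint_coe hS b)).Contiguous y.loop where
  size_eq := rfl
  face i hi := by
    have h0 := dist_samplePoint_lt hs hS (ℓ.pt i)
    have h1 := dist_samplePoint_lt hs hS (ℓ.pt (i + 1))
    have h2 : dist (ℓ.pt i) (y.y i) < s := y.near i (le_of_lt hi)
    have h3 : dist (ℓ.pt (i + 1)) (y.y (i + 1)) < s := y.near (i + 1) hi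
    have h4 : dist (ℓ.pt i) (ℓ.pt (i + 1)) < p := spanEdge_rips_iff.1 (ℓ.edge i hi)
    have h5 : dist (ℓ.pt (i + 1)) (ℓ.pt i) < p := by rwa [dist_comm]
    have h6 : ∀ z : X, dist z z < p := fun z => by rw [dist_self]; exact p.2
    exact exists_rips_face_of_four (sample_dist_lt_of_near h0 h1 h4) (sample_dist_lt_of_near h0 h2 (h6 _))
      (sample_dist_lt_of_near h0 h3 h4) (sample_dist_lt_of_near h1 h2 h5) (sample_dist_lt_of_near h1 h3 (h6 _))
      (sample_dist_lt_of_near h2 h3 h4)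

theorem contiguous_bond_sample (hs : 0 < s) (hS : IsDenseSample S s) {b : S} {p : Scale}
    (ℓ : SimplicialLoop (rips X p) (b : X)) :
    (ℓ.map ((ripsIncl S (p.add (2 * s))).comp (sampleMap hs hS p))
      (congrArg Subtype.val (samplePoint_coe hS b))).Contiguous
      (ℓ.map (ripsBond X (p.le_add (2 * s))) rfl) where
  size_eq := rfl
  face i hi := by
    have hs' : (0 : ℝ) < s := hs
    have h0 := dist_samplePoint_lt hs hS (ℓ.pt i)
    have h1 := dist_samplePoint_lt hs hS (ℓ.pt (i + 1))
    -- Each vertex of the original loop counts as its own nearby point, so the same estimate applies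
    -- to mixed pairs.
    have h2 : ∀ z : X, dist z z < s := fun z => by rw [dist_self]; exact hs'
    have h4 : dist (ℓ.pt i) (ℓ.pt (i + 1)) < p := spanEdge_rips_iff.1 (ℓ.edge i hi)
    have h5 : dist (ℓ.pt (i + 1)) (ℓ.pt i) < p := by rwa [dist_comm]
    have h6 : ∀ z : X, dist z z < p := fun z => by rw [dist_self]; exact p.2
    exact exists_rips_face_of_four (dist_lt_of_near h0 h1 h4) (dist_lt_of_near h0 (h2 _) (h6 _))
      (dist_lt_of_near h0 (h2 _) h4) (dist_lt_of_near h1 (h2 _) h5)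
      (dist_lt_of_near h1 (h2 _) (h6 _)) (dist_lt_of_near (h2 _) (h2 _) h4)

/-! ### The maps `ν`, their graphs and their composites with `μ` -/

/-- `ν_p` on fundamental groups. -/
def nuPi1 (hs : 0 < s) (hS : IsDenseSample S s) (b : S) (p : Scale) :
    (persPi1 X (b : X)).obj p ⟶ (persPi1 S b).obj (p.add (2 * s)) :=
  GrpCat.ofHom (Pi1.map (sampleMap hs hS p) (samplePoint_coe hS b))

/-- `ν_p` on first homology groups. -/
def nuH1 (hs : 0 < s) (hS : IsDenseSample S s) (G : Type w) [AddCommGroup G] (p : Scale) :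
    (persH1 X G).obj p ⟶ (persH1 S G).obj (p.add (2 * s)) :=
  AddCommGrpCat.ofHom (H1.map (sampleMap hs hS p) G)

/-- Contiguity makes the value on a loop independent of the chosen sample points; surjectivity of
the loop class puts every element in the domain of the relation. -/
theorem nuPi1_eq_iff (hs : 0 < s) (hS : IsDenseSample S s) (b : S) (p : Scale)
    (γ : Pi1 (rips X p) (b : X)) (δ : Pi1 (rips S (p.add (2 * s))) b) :
    (nuPi1 hs hS b p).hom γ = δ ↔ NuRelPi1 S s b p γ δ := by
  have hν : ∀ {ℓ : SimplicialLoop (rips X p) (b : X)} (y : SampleChoice S s b ℓ),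
      (nuPi1 hs hS b p).hom ℓ.classPi1 = y.loop.classPi1 := fun {ℓ} y =>
    (ℓ.map_classPi1 _ (samplePoint_coe hS b)).trans (y.contiguous hs hS).classPi1_eq
  constructor
  · rintro rfl
    obtain ⟨ℓ, rfl⟩ := SimplicialLoop.classPi1_surjective γ
    exact ⟨ℓ, .ofSamplePoint hs hS ℓ, rfl, (hν _).symm⟩
  · rintro ⟨ℓ, y, rfl, rfl⟩
    exact hν y

/-- The same argument loop by loop, extended by additivity; sums of based loops exhaust H₁ because
the complex is connected. -/
theorem nuH1_eq_iff (hX : IsGeodesicSpace X) (hs : 0 < s) (hS : IsDenseSample S s) (b : S)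
    (G : Type w) [AddCommGroup G] (p : Scale) (γ : H1 (rips X p) G)
    (δ : H1 (rips S (p.add (2 * s))) G) :
    (nuH1 hs hS G p).hom γ = δ ↔ NuRelH1 S s b G p γ δ := by
  have hν : ∀ {ℓ : SimplicialLoop (rips X p) (b : X)} (y : SampleChoice S s b ℓ) (g : G),
      H1.map (sampleMap hs hS p) G (ℓ.classH1 g) = y.loop.classH1 g := fun {ℓ} y g =>
    (ℓ.map_classH1 _ (samplePoint_coe hS b) g).trans ((y.contiguous hs hS).classH1_eq g)
  change H1.map (sampleMap hs hS p) G γ = δ ↔ _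
  constructor
  · rintro rfl
    obtain ⟨m, g, ℓ, rfl⟩ := H1.exists_sum_classH1 (exists_walkClass_rips hX G p (b : X)) γ
    refine ⟨m, g, ℓ, fun j => .ofSamplePoint hs hS (ℓ j), rfl, ?_⟩
    rw [map_sum]
    exact Finset.sum_congr rfl fun j _ => (hν _ _).symm
  · rintro ⟨m, g, ℓ, y, rfl, rfl⟩
    rw [map_sum]
    exact Finset.sum_congr rfl fun j _ => hν _ _

theorem muPi1_nuPi1 (hs : 0 < s) (hS : IsDenseSample S s) (b : S) (p : Scale) :
    muPi1 S b p ≫ nuPi1 hs hS b p = (persPi1 S b).map (homOfLE (p.le_add (2 * s))) := by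
  have e : (sampleMap hs hS p).comp (ripsIncl S p) = ripsBond S (p.le_add (2 * s)) :=
    SimplicialMap.ext (funext fun y => samplePoint_coe hS y)
  -- The base point proofs depend on the simplicial map, so both maps are generalized before being
  -- identified.
  have e' : ∀ (φ ψ : SimplicialMap (rips S p) (rips S (p.add (2 * s)))) (_ : φ = ψ)
      (h : φ.onVertices b = b) (h' : ψ.onVertices b = b), Pi1.map φ h = Pi1.map ψ h' := by
    rintro φ _ rfl _ _
    rfl
  exact GrpCat.hom_ext ((Pi1.map_comp (sampleMap hs hS p) (ripsIncl S p) rfl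
    (samplePoint_coe hS b) (samplePoint_coe hS b)).symm.trans (e' _ _ e _ rfl))

theorem muH1_nuH1 (hs : 0 < s) (hS : IsDenseSample S s) (G : Type w) [AddCommGroup G]
    (p : Scale) :
    muH1 S G p ≫ nuH1 hs hS G p = (persH1 S G).map (homOfLE (p.le_add (2 * s))) := by
  have e : (sampleMap hs hS p).comp (ripsIncl S p) = ripsBond S (p.le_add (2 * s)) :=
    SimplicialMap.ext (funext fun y => samplePoint_coe hS y)
  refine AddCommGrpCat.hom_ext ((H1.map_comp (sampleMap hs hS p) (ripsIncl S p) G).symm.trans ?_)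
  rw [e]
  rfl

/-- This composite can move vertices, so it matches the bonding map only up to contiguity, and the
equality is checked on loops. -/
theorem nuPi1_muPi1 (hs : 0 < s) (hS : IsDenseSample S s) (b : S) (p : Scale) :
    nuPi1 hs hS b p ≫ muPi1 S b (p.add (2 * s)) =
      (persPi1 X (b : X)).map (homOfLE (p.le_add (2 * s))) := by
  refine GrpCat.hom_ext ((Pi1.map_comp (ripsIncl S _) (sampleMap hs hS p)
    (samplePoint_coe hS b) rfl (congrArg Subtype.val (samplePoint_coe hS b))).symm.trans ?_)
  refine MonoidHom.ext fun γ => ?_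
  obtain ⟨ℓ, rfl⟩ := SimplicialLoop.classPi1_surjective γ
  exact ((ℓ.map_classPi1 _ _).trans (contiguous_bond_sample hs hS ℓ).classPi1_eq).trans
    (ℓ.map_classPi1 _ _).symm

theorem nuH1_muH1 (hX : IsGeodesicSpace X) (hs : 0 < s) (hS : IsDenseSample S s) (b : S)
    (G : Type w) [AddCommGroup G] (p : Scale) :
    nuH1 hs hS G p ≫ muH1 S G (p.add (2 * s)) =
      (persH1 X G).map (homOfLE (p.le_add (2 * s))) := by
  refine AddCommGrpCat.hom_ext ((H1.map_comp (ripsIncl S _) (sampleMap hs hS p) G).symm.trans ?_)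
  refine AddMonoidHom.ext fun γ => ?_
  obtain ⟨m, g, ℓ, rfl⟩ := H1.exists_sum_classH1 (exists_walkClass_rips hX G p (b : X)) γ
  change H1.map _ G _ = H1.map (ripsBond X (p.le_add (2 * s))) G _
  rw [map_sum, map_sum]
  refine Finset.sum_congr rfl fun j _ => ?_
  exact (((ℓ j).map_classH1 _ (congrArg Subtype.val (samplePoint_coe hS b)) _).trans
    ((contiguous_bond_sample hs hS (ℓ j)).classH1_eq _)).trans ((ℓ j).map_classH1 _ rfl _).symm

/-! ### Compatibility with the bonding maps -/

theorem bond_muPi1 (S : Set X) (b : S) {p q : Scale} (h : p ≤ q) :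
    (persPi1 S b).map (homOfLE h) ≫ muPi1 S b q =
      muPi1 S b p ≫ (persPi1 X (b : X)).map (homOfLE h) :=
  GrpCat.hom_ext ((Pi1.map_comp (ripsIncl S q) (ripsBond S h) rfl rfl rfl).symm.trans
    (Pi1.map_comp (ripsBond X h) (ripsIncl S p) rfl rfl rfl))

theorem bond_muH1 (S : Set X) (G : Type w) [AddCommGroup G] {p q : Scale} (h : p ≤ q) :
    (persH1 S G).map (homOfLE h) ≫ muH1 S G q = muH1 S G p ≫ (persH1 X G).map (homOfLE h) :=
  AddCommGrpCat.hom_ext ((H1.map_comp (ripsIncl S q) (ripsBond S h) G).symm.trans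
    (H1.map_comp (ripsBond X h) (ripsIncl S p) G))

/-- The vertex map `samplePoint` is the same at every scale, so both composites agree on vertices.
-/
theorem bond_nuPi1 (hs : 0 < s) (hS : IsDenseSample S s) (b : S) {p q : Scale} (h : p ≤ q) :
    (persPi1 X (b : X)).map (homOfLE h) ≫ nuPi1 hs hS b q =
      nuPi1 hs hS b p ≫ (persPi1 S b).map (homOfLE (Scale.add_le_add h (2 * s))) :=
  GrpCat.hom_ext ((Pi1.map_comp (sampleMap hs hS q) (ripsBond X h) rfl (samplePoint_coe hS b)
    (samplePoint_coe hS b)).symm.trans (Pi1.map_comp (ripsBond S (Scale.add_le_add h (2 * s)))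
      (sampleMap hs hS p) (samplePoint_coe hS b) rfl (samplePoint_coe hS b)))

theorem bond_nuH1 (hs : 0 < s) (hS : IsDenseSample S s) (G : Type w) [AddCommGroup G]
    {p q : Scale} (h : p ≤ q) :
    (persH1 X G).map (homOfLE h) ≫ nuH1 hs hS G q =
      nuH1 hs hS G p ≫ (persH1 S G).map (homOfLE (Scale.add_le_add h (2 * s))) :=
  AddCommGrpCat.hom_ext ((H1.map_comp (sampleMap hs hS q) (ripsBond X h) G).symm.trans
    (H1.map_comp (ripsBond S (Scale.add_le_add h (2 * s))) (sampleMap hs hS p) G))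

end Sample

/-- Families `μ_r` and `ν_r` commuting with the bonding maps and composing to bonding maps form a
`(0, c)`-interleaving. -/
def Interleaving.ofZero {C : Type*} [Category C] {c : ℝ≥0} {P Q : Scale ⥤ C}
    (μ : ∀ r : Scale, P.obj r ⟶ Q.obj r) (ν : ∀ r : Scale, Q.obj r ⟶ P.obj (r.add c))
    (hμ : ∀ (r r' : Scale) (h : r ≤ r'),
      P.map (homOfLE h) ≫ μ r' = μ r ≫ Q.map (homOfLE h))
    (hν : ∀ (r r' : Scale) (h : r ≤ r'),
      Q.map (homOfLE h) ≫ ν r' = ν r ≫ P.map (homOfLE (Scale.add_le_add h c)))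
    (hμν : ∀ r : Scale, μ r ≫ ν r = P.map (homOfLE (r.le_add c)))
    (hνμ : ∀ r : Scale, ν r ≫ μ (r.add c) = Q.map (homOfLE (r.le_add c))) :
    Interleaving 0 c P Q where
  -- The scale `r.add 0` is not definitionally `r`, hence the extra bonding map.
  f r := μ r ≫ Q.map (homOfLE (r.le_add 0))
  g := ν
  f_bond r r' h := by
    rw [← Category.assoc, hμ r r' h, Category.assoc, Category.assoc, ← Q.map_comp, ← Q.map_comp]
    rfl
  g_bond := hν
  f_g r := by
    -- Naturality of `ν` moves the bonding map from `r` to `r.add 0` past it; what remains is a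
    -- composite of bonding maps of `P`.
    rw [Category.assoc, hν, ← Category.assoc, hμν, ← P.map_comp]
    rfl
  g_f r := by
    rw [← Category.assoc, hνμ, ← Q.map_comp]
    rfl

end

theorem mainTheorem6 {X : Type u} [MetricSpace X] (hX : IsGeodesicSpace X)
    (G : Type w) [AddCommGroup G] (S : Set X) (b : S) (s : ℝ≥0) (hs : 0 < s)
    (hS : IsDenseSample S s) :
    (∃ ν : ∀ p : Scale, (persPi1 X (b : X)).obj p ⟶ (persPi1 S b).obj (p.add (2 * s)),
      (∀ p γ δ, (ν p).hom γ = δ ↔ NuRelPi1 S s b p γ δ) ∧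
      (∀ p, muPi1 S b p ≫ ν p = (persPi1 S b).map (homOfLE (p.le_add (2 * s)))) ∧
      (∀ p, ν p ≫ muPi1 S b (p.add (2 * s)) =
        (persPi1 X (b : X)).map (homOfLE (p.le_add (2 * s)))) ∧
      (∀ (p q : Scale) (hpq : p < q), (persPi1 S b).map (homOfLE hpq.le) ≫ muPi1 S b q =
        muPi1 S b p ≫ (persPi1 X (b : X)).map (homOfLE hpq.le)) ∧
      ∃ I : Interleaving 0 (2 * s) (persPi1 S b) (persPi1 X (b : X)),
        (∀ p, I.f p =
          muPi1 S b p ≫ (persPi1 X (b : X)).map (homOfLE (p.le_add 0))) ∧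
        ∀ p, I.g p = ν p) ∧
    (∃ ν : ∀ p : Scale, (persH1 X G).obj p ⟶ (persH1 S G).obj (p.add (2 * s)),
      (∀ p γ δ, (ν p).hom γ = δ ↔ NuRelH1 S s b G p γ δ) ∧
      (∀ p, muH1 S G p ≫ ν p = (persH1 S G).map (homOfLE (p.le_add (2 * s)))) ∧
      (∀ p, ν p ≫ muH1 S G (p.add (2 * s)) =
        (persH1 X G).map (homOfLE (p.le_add (2 * s)))) ∧
      (∀ (p q : Scale) (hpq : p < q), (persH1 S G).map (homOfLE hpq.le) ≫ muH1 S G q =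
        muH1 S G p ≫ (persH1 X G).map (homOfLE hpq.le)) ∧
      ∃ I : Interleaving 0 (2 * s) (persH1 S G) (persH1 X G),
        (∀ p, I.f p = muH1 S G p ≫ (persH1 X G).map (homOfLE (p.le_add 0))) ∧
        ∀ p, I.g p = ν p) := by
  refine ⟨⟨nuPi1 hs hS b, nuPi1_eq_iff hs hS b, muPi1_nuPi1 hs hS b, nuPi1_muPi1 hs hS b,
    fun p q hpq => bond_muPi1 S b hpq.le, ?_⟩, ⟨nuH1 hs hS G, nuH1_eq_iff hX hs hS b G,
    muH1_nuH1 hs hS G, nuH1_muH1 hX hs hS b G, fun p q hpq => bond_muH1 S G hpq.le, ?_⟩⟩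
  · exact ⟨.ofZero (muPi1 S b) (nuPi1 hs hS b) (fun _ _ h => bond_muPi1 S b h)
      (fun _ _ h => bond_nuPi1 hs hS b h) (muPi1_nuPi1 hs hS b) (nuPi1_muPi1 hs hS b),
      fun _ => rfl, fun _ => rfl⟩
  · exact ⟨.ofZero (muH1 S G) (nuH1 hs hS G) (fun _ _ h => bond_muH1 S G h)
      (fun _ _ h => bond_nuH1 hs hS G h) (muH1_nuH1 hs hS G) (nuH1_muH1 hX hs hS b G),
      fun _ => rfl, fun _ => rfl⟩
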